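/- Let $K$ denote prefix-free Kolmogorov complexity with respect to an arbitrary universal (additively optimal) prefix-free machine, natural numbers being coded by their binary expansions. A function $f\colon\mathbb{N}\to\mathbb{N}$ is *right-c.e.* if there are computable functions $p,q\colon\mathbb{N}\times\mathbb{N}\to\mathbb{N}$ such that for every $n$ the dyadic rationals $f_t(n)=p(n,t)\,2^{-q(n,t)}$ are nonincreasing in $t$ and converge to $f(n)$. It is a *weak Solovay function* if it is right-c.e., there is a constant $c$ with $K(n)\le f(n)+c$ for all $n$, and there is a constant $c'$ with $f(n)\le K(n)+c'$ for infinitely many $n$. A *Martin-Löf test* is a sequence $(V_c)_{c\in\mathbb{N}}$ of subsets of $\mathbb{R}$ such that, uniformly in $c$, $V_c$ is the union of a computably enumerable set of open intervals with rational endpoints, and the Lebesgue measure of $V_c$ is at most $2^{-c}$; a real number is *Martin-Löf random* if for every Martin-Löf test $(V_c)_c$ it lies outside $\bigcap_c V_c$. **Theorem.** Let $f\colon\mathbb{N}\to\mathbb{N}$ be a right-c.e. function. Then $f$ is a weak Solovay function if and only if $\sum_{n} 2^{-f(n)}$ is finite and is a Martin-Löf random real. -/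

import Mathlib

open Filter MeasureTheory
open scoped Topology ENNReal

/-! Prefix-free machines and prefix-free Kolmogorov complexity -/

/-- A prefix-free machine: a partial computable function on finite binary strings whose domain
contains no two distinct strings one of which is a prefix of the other. -/
def IsPrefixFreeMachine (M : List Bool →. List Bool) : Prop :=
  Partrec M ∧ ∀ p q : List Bool, (M p).Dom → (M q).Dom → p <+: q → p = q

/-- A universal (that is, additively optimal) prefix-free machine: it simulates every prefix-free
machine, with programs that are longer by at most a constant depending on that machine. -/
def IsUniversalPrefixFree (U : List Bool →. List Bool) : Prop :=
  IsPrefixFreeMachine U ∧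
    ∀ M : List Bool →. List Bool, IsPrefixFreeMachine M →
      ∃ c : ℕ, ∀ p x : List Bool, x ∈ M p → ∃ q : List Bool, x ∈ U q ∧ q.length ≤ p.length + c

/-- The complexity of the string `x` with respect to the machine `U`: the length of a shortest
`U`-program for `x`. If `U` is universal then every string has a program. -/
noncomputable def prefixComplexity (U : List Bool →. List Bool) (x : List Bool) : ℕ :=
  sInf {l : ℕ | ∃ p : List Bool, x ∈ U p ∧ p.length = l}

/-- The complexity of a natural number, coded as a string by its binary expansion (least
significant bit first, with `0` coded by the empty string); a different effective coding would
change the complexity by at most an additive constant. -/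
noncomputable def prefixComplexityNat (U : List Bool →. List Bool) (n : ℕ) : ℕ :=
  prefixComplexity U (Nat.bits n)

/-! Right-c.e. functions and weak Solovay functions -/

/-- `f` is right-c.e.: there is a computable approximation by dyadic rationals
`f_t(n) = p(n,t) / 2 ^ q(n,t)` that is nonincreasing in `t` and converges to `f n`. -/
def IsRightCE (f : ℕ → ℕ) : Prop :=
  ∃ p q : ℕ → ℕ → ℕ, Computable₂ p ∧ Computable₂ q ∧
    ∀ n : ℕ, Antitone (fun t => (p n t : ℝ) / 2 ^ q n t) ∧
      Tendsto (fun t => (p n t : ℝ) / 2 ^ q n t) atTop (𝓝 (f n : ℝ))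

/-- `f` is a weak Solovay function, where complexity is taken with respect to `U`: it is
right-c.e., `K ≤ f + O(1)`, and `f(n) ≤ K(n) + O(1)` for infinitely many `n`. -/
def IsWeakSolovay (U : List Bool →. List Bool) (f : ℕ → ℕ) : Prop :=
  IsRightCE f ∧
    (∃ c : ℕ, ∀ n : ℕ, prefixComplexityNat U n ≤ f n + c) ∧
    (∃ c : ℕ, ∃ᶠ n in atTop, f n ≤ prefixComplexityNat U n + c)

/-! Martin-Löf randomness for real numbers -/

/-- The rational number `(p - q) / (r + 1)` coded by the triple `(p, q, r)` of natural numbers;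
every rational number has such a code. -/
def ratOfCode (a : ℕ × ℕ × ℕ) : ℚ := ((a.1 : ℚ) - (a.2.1 : ℚ)) / ((a.2.2 : ℚ) + 1)

/-- The sets `V c` of reals are effectively open uniformly in `c`: a single c.e. set of triples
`(c, a, b)` enumerates, for every `c`, open intervals with rational endpoints (given by codes)
whose union is `V c`. -/
def UniformlyEffectivelyOpen (V : ℕ → Set ℝ) : Prop :=
  ∃ W : ℕ × (ℕ × ℕ × ℕ) × (ℕ × ℕ × ℕ) → Prop, REPred W ∧
    ∀ c : ℕ, V c = {x : ℝ | ∃ a b : ℕ × ℕ × ℕ,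
      W (c, a, b) ∧ x ∈ Set.Ioo (ratOfCode a : ℝ) (ratOfCode b : ℝ)}

/-- A Martin-Löf test on the real line. -/
def IsMartinLofTest (V : ℕ → Set ℝ) : Prop :=
  UniformlyEffectivelyOpen V ∧ ∀ c : ℕ, volume (V c) ≤ (2⁻¹ : ℝ≥0∞) ^ c

/-- A real is Martin-Löf random if no Martin-Löf test covers it. -/
def IsMartinLofRandom (x : ℝ) : Prop :=
  ∀ V : ℕ → Set ℝ, IsMartinLofTest V → ∃ c : ℕ, x ∉ V c

/-! Universal prefix-free machines exist -/

namespace UniversalMachine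

open Nat.Partrec (Code)

/-- The triple (machine index, program, time bound) considered at stage `t`. -/
def stage (t : ℕ) : ℕ × List Bool × ℕ :=
  (Encodable.decode (α := ℕ × List Bool × ℕ) t).getD (0, [], 0)

/-- The program `0^e 1 σ` considered at stage `t`. -/
def prog (t : ℕ) : List Bool :=
  ((List.range (stage t).1).map fun _ => false) ++ true :: (stage t).2.1

/-- The output found at stage `t`, if any. -/
def val (t : ℕ) : Option (List Bool) :=
  (Code.evaln (stage t).2.2 (Denumerable.ofNat Code (stage t).1)
    (Encodable.encode (stage t).2.1)).bind fun v => Encodable.decode (α := List Bool) v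

/-- At stage `t` a halting computation is found whose program is comparable with `x`. -/
def hit (x : List Bool) (t : ℕ) : Bool :=
  (val t).isSome && (decide ((prog t).take x.length = x.take (prog t).length))

/-- Find the first halting computation with a program comparable with `x`, and give its output
if that program is `x` itself. -/
def machine : List Bool →. List Bool := fun x =>
  (Nat.rfind fun t => Part.some (hit x t)).bind fun t =>
    ((if prog t = x then val t else none : Option (List Bool)) : Part (List Bool))

theorem primrec_stage : Primrec stage :=
  Primrec.option_getD.comp Primrec.decode (Primrec.const _)

theorem primrec_prog : Primrec prog := by
  refine Primrec.list_append.comp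
    (Primrec.list_map (Primrec.list_range.comp (Primrec.fst.comp primrec_stage))
      (Primrec.const false).to₂)
    (Primrec.list_cons.comp (Primrec.const true)
      (Primrec.fst.comp (Primrec.snd.comp primrec_stage)))

theorem primrec_val : Primrec val := by
  refine Primrec.option_bind (Code.primrec_evaln.comp (Primrec.pair (Primrec.pair
    (Primrec.snd.comp (Primrec.snd.comp primrec_stage))
    ((Primrec.ofNat Code).comp (Primrec.fst.comp primrec_stage)))
    (Primrec.encode.comp (Primrec.fst.comp (Primrec.snd.comp primrec_stage)))))
    (Primrec.decode.comp Primrec.snd).to₂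

theorem primrec_hit : Primrec₂ hit := by
  have h1 : PrimrecPred fun z : List Bool × ℕ =>
      (prog z.2).take z.1.length = z.1.take (prog z.2).length :=
    Primrec.eq.comp
      (Primrec.list_take.comp (Primrec.list_length.comp Primrec.fst)
        (primrec_prog.comp Primrec.snd))
      (Primrec.list_take.comp (Primrec.list_length.comp (primrec_prog.comp Primrec.snd))
        Primrec.fst)
  exact Primrec.and.comp (Primrec.option_isSome.comp (primrec_val.comp Primrec.snd)) h1.decide

theorem partrec_machine : Partrec machine := by
  refine Partrec.bind (Partrec.rfind primrec_hit.to_comp.partrec₂) ?_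
  refine Computable.ofOption (Primrec.to_comp ?_)
  exact Primrec.ite (Primrec.eq.comp (primrec_prog.comp Primrec.snd) Primrec.fst)
    (primrec_val.comp Primrec.snd) (Primrec.const none)

theorem mem_machine {x y : List Bool} : y ∈ machine x ↔
    ∃ t, hit x t = true ∧ (∀ s < t, hit x s = false) ∧ prog t = x ∧ val t = some y := by
  have hr : ∀ t, (t ∈ Nat.rfind fun t => Part.some (hit x t)) ↔
      hit x t = true ∧ ∀ s < t, hit x s = false := fun t => by
    refine (Nat.mem_rfind (p := fun t => Part.some (hit x t))).trans ?_
    simp only [Part.mem_some_iff]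
    exact ⟨fun h => ⟨h.1.symm, fun s hs => (h.2 hs).symm⟩,
      fun h => ⟨h.1.symm, fun {s} hs => (h.2 s hs).symm⟩⟩
  simp only [machine, Part.mem_bind_iff, hr]
  constructor
  · rintro ⟨t, ⟨h1, h2⟩, h3⟩
    by_cases h : prog t = x
    · exact ⟨t, h1, h2, h, by simpa [h] using h3⟩
    · simp [h] at h3
  · rintro ⟨t, h1, h2, h3, h4⟩
    exact ⟨t, ⟨h1, h2⟩, by simp [h3, h4]⟩

theorem take_eq_of_prefix {p q : List Bool} (h : p <+: q) :
    p.take q.length = q.take p.length := by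
  rw [← List.prefix_iff_eq_take.1 h, List.take_of_length_le h.length_le]

theorem prefix_or_of_take_eq {p q : List Bool} (h : p.take q.length = q.take p.length) :
    p <+: q ∨ q <+: p := by
  rcases le_total p.length q.length with hl | hl
  · left; rw [List.take_of_length_le hl] at h; exact List.prefix_iff_eq_take.2 h
  · right; rw [List.take_of_length_le hl] at h; exact List.prefix_iff_eq_take.2 h.symm

theorem isPrefixFreeMachine_machine : IsPrefixFreeMachine machine := by
  refine ⟨partrec_machine, fun p q hp hq hpq => ?_⟩
  obtain ⟨y, hy⟩ := Part.dom_iff_mem.1 hp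
  obtain ⟨z, hz⟩ := Part.dom_iff_mem.1 hq
  obtain ⟨t, -, ht, rfl, hv⟩ := mem_machine.1 hy
  obtain ⟨s, -, hs, rfl, hw⟩ := mem_machine.1 hz
  have h1 : hit (prog s) t = true := by simp [hit, hv, take_eq_of_prefix hpq]
  have h2 : hit (prog t) s = true := by simp [hit, hw, take_eq_of_prefix hpq]
  have : s = t := by
    rcases lt_trichotomy s t with h | h | h
    · simp [ht s h] at h2
    · exact h
    · simp [hs t h] at h1
  rw [this]

theorem prefix_code {d e : ℕ} {σ τ : List Bool}
    (h : ((List.range d).map fun _ => false) ++ true :: σ <+: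
      ((List.range e).map fun _ => false) ++ true :: τ) : d = e ∧ σ <+: τ := by
  simp only [List.map_const', List.length_range] at h
  induction d generalizing e with
  | zero =>
    cases e with
    | zero => simpa using h
    | succ e => simp [List.replicate_succ] at h
  | succ d ih =>
    cases e with
    | zero => simp [List.replicate_succ] at h
    | succ e =>
      simp only [List.replicate_succ, List.cons_append, List.cons_prefix_cons, true_and] at h
      simpa using ih h

theorem isUniversalPrefixFree_machine : IsUniversalPrefixFree machine := by
  refine ⟨isPrefixFreeMachine_machine, fun M hM => ?_⟩
  obtain ⟨c, hc⟩ := Code.exists_code.1 hM.1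
  have key : ∀ p x, x ∈ M p ↔ Encodable.encode x ∈ Code.eval c (Encodable.encode p) := by
    intro p x
    rw [hc]
    simp
  refine ⟨Encodable.encode c + 1, fun p x hx => ?_⟩
  obtain ⟨k, hk⟩ := Code.evaln_complete.1 ((key p x).1 hx)
  set q : List Bool := ((List.range (Encodable.encode c)).map fun _ => false) ++ true :: p with hq
  have hex : ∃ t, hit q t = true := by
    refine ⟨Encodable.encode (Encodable.encode c, p, k), ?_⟩
    have h1 : stage (Encodable.encode (Encodable.encode c, p, k)) = (Encodable.encode c, p, k) :=
      by simp only [stage, Encodable.encodek, Option.getD_some]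
    have h2 := Option.mem_def.1 hk
    simp only [hit, val, prog, h1, hq, Denumerable.ofNat_encode, h2, Option.bind_some,
      Encodable.encodek, Option.isSome_some, Bool.true_and, decide_true]
  classical
  have hspec := Nat.find_spec hex
  have hmin : ∀ s < Nat.find hex, hit q s = false := fun s hs => by
    simpa using Nat.find_min hex hs
  generalize Nat.find hex = t at hspec hmin
  have hspec' := hspec
  simp only [hit, Bool.and_eq_true, decide_eq_true_eq] at hspec'
  obtain ⟨h1, h2⟩ := hspec'
  obtain ⟨y, hy⟩ := Option.isSome_iff_exists.1 h1
  have hcmp : (stage t).1 = Encodable.encode c ∧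
      ((stage t).2.1 <+: p ∨ p <+: (stage t).2.1) := by
    rcases prefix_or_of_take_eq h2 with h | h
    · obtain ⟨a, b⟩ := prefix_code h
      exact ⟨a, Or.inl b⟩
    · obtain ⟨a, b⟩ := prefix_code h
      exact ⟨a.symm, Or.inr b⟩
  have hval := hy
  simp only [val, hcmp.1, Denumerable.ofNat_encode, Option.bind_eq_some_iff] at hval
  obtain ⟨v, hv, hvy⟩ := hval
  have hmem : y ∈ M (stage t).2.1 := by
    have h := Code.evaln_sound hv
    rw [hc] at h
    simp only [Encodable.encodek, Part.coe_some, Part.bind_some, Part.mem_map_iff] at h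
    obtain ⟨z, hz, rfl⟩ := h
    rw [Encodable.encodek, Option.some.injEq] at hvy
    rwa [← hvy]
  have hd1 : (M (stage t).2.1).Dom := Part.dom_iff_mem.2 ⟨_, hmem⟩
  have hd2 : (M p).Dom := Part.dom_iff_mem.2 ⟨_, hx⟩
  have hp : (stage t).2.1 = p := by
    rcases hcmp.2 with h | h
    · exact hM.2 _ _ hd1 hd2 h
    · exact (hM.2 _ _ hd2 hd1 h).symm
  rw [hp] at hmem
  have hxv := Part.mem_unique hmem hx
  refine ⟨q, mem_machine.2 ⟨t, hspec, hmin, ?_, by rw [hy, hxv]⟩, ?_⟩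
  · simp only [prog, hcmp.1, hp, hq]
  · simp [hq]; omega

end UniversalMachine

theorem exists_isUniversalPrefixFree : ∃ U : List Bool →. List Bool, IsUniversalPrefixFree U :=
  ⟨_, UniversalMachine.isUniversalPrefixFree_machine⟩

/-! Write `x` for the sum of `2 ^ (-f n)` and `a t` for its increasing computable approximation
`approxSum g t`, where `g` approximates `f` from above.

Weak Solovay implies random. Summability follows from `K ≤ f + O(1)` and the Kraft inequality.
Suppose a test `V` covers `x`. Call a stage `t` `c`-active if one interval already enumerated into
`V (2 * c)` contains both `a t` and `a (t + 1)`. The active increments are disjoint intervals inside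
`V (2 * c)`, so they have total length at most `4 ^ (-c)`. Requesting descriptions of length `g n (t
+ 1) - c` for the numbers `n` whose terms grow at active stages therefore costs `O(2 ^ (-c))`, and
all levels `c` together satisfy the Kraft–Chaitin theorem (`IsNatApprox.exists_program_of_active`).
As `x` lies in the open set `V (2 * c)`, all late stages are active, and every large `n` attains its
final term at a late stage. Hence `K n ≤ f n - c + C` for almost all `n`, with `C` independent of
`c`, which contradicts `f ≤ K + O(1)` infinitely often.

Random implies weak Solovay. The same compression with all stages active at level `0` gives `K ≤ f +
O(1)`. If `f ≤ K + O(1)` failed to hold infinitely often, then `f - K` would tend to infinity. The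
sum of `potential (f n) (K n)` is finite, being at most twice the sum of `2 ^ (-K n)`, and has
increasing computable approximations. When `f n - K n ≥ m`, what is missing from the term of `n` in
this sum is at least `m` times what is missing from `2 ^ (-f n)`. So for every `c` there is a stage
from which `x` has less than `2 ^ (-c)` times as far to grow as a bounded left-c.e. quantity
(`not_isMartinLofRandom_of_gap`), and such an `x` is caught by a test
(`not_isMartinLofRandom_of_increments`). -/

/-! ### Computability of arithmetic expressions -/

section Computability

variable {α β : Type*} [Primcodable α] [Primcodable β]

theorem Computable.natAdd {f g : α → ℕ} (hf : Computable f) (hg : Computable g) :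
    Computable fun a => f a + g a :=
  Primrec.nat_add.to_comp.comp hf hg

theorem Computable.natMul {f g : α → ℕ} (hf : Computable f) (hg : Computable g) :
    Computable fun a => f a * g a :=
  Primrec.nat_mul.to_comp.comp hf hg

theorem Computable.natSub {f g : α → ℕ} (hf : Computable f) (hg : Computable g) :
    Computable fun a => f a - g a :=
  Primrec.nat_sub.to_comp.comp hf hg

theorem Computable.natDiv {f g : α → ℕ} (hf : Computable f) (hg : Computable g) :
    Computable fun a => f a / g a :=
  Primrec.nat_div.to_comp.comp hf hg

theorem Computable.natMax {f g : α → ℕ} (hf : Computable f) (hg : Computable g) :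
    Computable fun a => max (f a) (g a) :=
  Primrec.nat_max.to_comp.comp hf hg

theorem Computable.ifThenElse {c : α → Prop} [DecidablePred c] {f g : α → β}
    (hc : ComputablePred c) (hf : Computable f) (hg : Computable g) :
    Computable fun a => if c a then f a else g a := by
  simpa [Bool.cond_decide] using hc.decide.cond hf hg

theorem ComputablePred.natLT {f g : α → ℕ} (hf : Computable f) (hg : Computable g) :
    ComputablePred fun a => f a < g a :=
  ⟨inferInstance, Primrec.nat_lt.decide.to_comp.comp hf hg⟩

theorem ComputablePred.natLE {f g : α → ℕ} (hf : Computable f) (hg : Computable g) :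
    ComputablePred fun a => f a ≤ g a :=
  ⟨inferInstance, Primrec.nat_le.decide.to_comp.comp hf hg⟩

theorem ComputablePred.equal [DecidableEq β] {f g : α → β} (hf : Computable f)
    (hg : Computable g) : ComputablePred fun a => f a = g a :=
  ⟨inferInstance, (Primrec.eq (α := β)).decide.to_comp.comp hf hg⟩

theorem ComputablePred.conj {p q : α → Prop} (hp : ComputablePred p) (hq : ComputablePred q) :
    ComputablePred fun a => p a ∧ q a := by
  classical
  exact ⟨inferInstance, (Primrec.and.to_comp.comp hp.decide hq.decide).of_eq fun a => by simp⟩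

theorem ComputablePred.comap {p : β → Prop} (hp : ComputablePred p) {f : α → β}
    (hf : Computable f) : ComputablePred fun a => p (f a) := by
  classical
  exact ⟨inferInstance, hp.decide.comp hf⟩

theorem Computable.natPow {f g : α → ℕ} (hf : Computable f) (hg : Computable g) :
    Computable fun a => f a ^ g a := by
  have h : Computable fun a => Nat.rec (motive := fun _ => ℕ) 1 (fun _ ih => ih * f a) (g a) :=
    Computable.nat_rec (h := fun a z => z.2 * f a) hg (Computable.const 1)
      (Computable.natMul (Computable.snd.comp Computable.snd) (hf.comp Computable.fst)).to₂
  refine h.of_eq fun a => ?_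
  induction g a with
  | zero => simp
  | succ n ih => simp only [ih, pow_succ]

theorem Computable.rangeSum {h : α → ℕ → ℕ} {g : α → ℕ} (hh : Computable₂ h)
    (hg : Computable g) : Computable fun a => ∑ i ∈ Finset.range (g a), h a i := by
  have key : Computable fun a =>
      Nat.rec (motive := fun _ => ℕ) 0 (fun i ih => ih + h a i) (g a) :=
    Computable.nat_rec (h := fun a z => z.2 + h a z.1) hg (Computable.const 0)
      (Computable.natAdd (Computable.snd.comp Computable.snd)
        (hh.comp Computable.fst (Computable.fst.comp Computable.snd))).to₂
  refine key.of_eq fun a => ?_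
  induction g a with
  | zero => simp
  | succ n ih => simp only [ih, Finset.sum_range_succ]

theorem ComputablePred.existsLT {p : α → ℕ → Prop} {g : α → ℕ}
    (hp : ComputablePred fun z : α × ℕ => p z.1 z.2) (hg : Computable g) :
    ComputablePred fun a => ∃ i < g a, p a i := by
  classical
  have h1 : Computable₂ fun a i => if p a i then 1 else 0 :=
    Computable.ifThenElse hp (Computable.const 1) (Computable.const 0)
  have h2 := Computable.rangeSum h1 hg
  refine (ComputablePred.natLT (Computable.const 0) h2).of_eq fun a => ?_
  rw [Finset.sum_pos_iff]
  refine exists_congr fun i => ?_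
  by_cases h : p a i <;> simp [h]

theorem REPred.existsNat {p : α → ℕ → Prop} (hp : ComputablePred fun z : α × ℕ => p z.1 z.2) :
    REPred fun a => ∃ i, p a i := by
  classical
  have h : Partrec fun a => Nat.rfind fun n => Part.some (decide (p a n)) :=
    Partrec.rfind hp.decide.partrec
  refine h.dom_re.of_eq fun a => ?_
  refine (Nat.rfind_dom (p := fun n => Part.some (decide (p a n)))).trans ?_
  simp

/-- A partial computable function is the limit of a computable increasing sequence of finite
partial functions. -/
theorem Partrec.exists_stages {f : α →. β} (hf : Partrec f) :
    ∃ F : α → ℕ → Option β, Computable₂ F ∧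
      (∀ a s t b, s ≤ t → F a s = some b → F a t = some b) ∧
      ∀ a b, b ∈ f a ↔ ∃ s, F a s = some b := by
  obtain ⟨c, hc⟩ := Nat.Partrec.Code.exists_code.1 hf
  refine ⟨fun a s => (Nat.Partrec.Code.evaln s c (Encodable.encode a)).bind
    fun v => Encodable.decode (α := β) v, ?_, ?_, ?_⟩
  · refine Primrec.to_comp (Primrec.option_bind (Nat.Partrec.Code.primrec_evaln.comp
      (Primrec.pair (Primrec.pair Primrec.snd (Primrec.const c))
        (Primrec.encode.comp Primrec.fst))) (Primrec.decode.comp Primrec.snd).to₂)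
  · intro a s t b hst h
    obtain ⟨v, hv, hb⟩ := Option.bind_eq_some_iff.1 h
    exact Option.bind_eq_some_iff.2 ⟨v, Nat.Partrec.Code.evaln_mono hst hv, hb⟩
  · intro a b
    have key : ∀ v, v ∈ Nat.Partrec.Code.eval c (Encodable.encode a) ↔
        ∃ b ∈ f a, Encodable.encode b = v := by
      intro v
      rw [hc]
      simp
    constructor
    · intro h
      obtain ⟨s, hs⟩ := Nat.Partrec.Code.evaln_complete.1 ((key _).2 ⟨b, h, rfl⟩)
      exact ⟨s, Option.bind_eq_some_iff.2 ⟨_, hs, Encodable.encodek b⟩⟩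
    · rintro ⟨s, h⟩
      obtain ⟨v, hv, hb⟩ := Option.bind_eq_some_iff.1 h
      obtain ⟨b', hb', rfl⟩ := (key v).1 (Nat.Partrec.Code.evaln_sound hv)
      rw [Encodable.encodek, Option.some.injEq] at hb
      rwa [← hb]

theorem REPred.exists_stages {p : α → Prop} (hp : REPred p) :
    ∃ P : α → ℕ → Prop, (ComputablePred fun z : α × ℕ => P z.1 z.2) ∧
      (∀ a s t, s ≤ t → P a s → P a t) ∧ ∀ a, p a ↔ ∃ s, P a s := by
  obtain ⟨F, hF, hmono, hlim⟩ := Partrec.exists_stages hp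
  refine ⟨fun a s => F a s = some (), ComputablePred.equal hF (Computable.const _),
    fun a s t hst h => hmono a s t _ hst h, fun a => ?_⟩
  rw [← hlim]
  simp

/-! ### Binary expansions of natural numbers. -/

theorem bits_eq_cons {n : ℕ} (hn : 0 < n) : n.bits = n.bodd :: n.div2.bits := by
  conv_lhs => rw [← Nat.bit_bodd_div2 n]
  refine Nat.bits_append_bit _ _ fun h0 => ?_
  by_contra hb
  have := Nat.bit_bodd_div2 n
  rw [h0, Bool.eq_false_iff.2 hb] at this
  simp at this
  omega

theorem foldr_bits (n : ℕ) : n.bits.foldr Nat.bit 0 = n := by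
  induction n using Nat.strong_induction_on with
  | _ n ih =>
    rcases Nat.eq_zero_or_pos n with rfl | hn
    · simp
    · rw [bits_eq_cons hn, List.foldr_cons, ih _ (by rw [Nat.div2_val]; omega),
        Nat.bit_bodd_div2]

theorem bits_injective : Function.Injective Nat.bits :=
  Function.LeftInverse.injective foldr_bits

theorem primrec_bits : Primrec Nat.bits := by
  have h : Primrec₂ fun (_ : Unit) n => Nat.bits n := by
    refine Primrec.nat_strong_rec (fun (_ : Unit) n => Nat.bits n)
      -- Course-of-values recursion: `L` lists the expansions of the numbers below `n`, so
      -- `L.length` is `n` itself.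
      (g := fun _ L => if L.length = 0 then some []
        else (L[L.length.div2]?).map fun l => L.length.bodd :: l) ?_ ?_
    · have hlen : Primrec fun z : Unit × List (List Bool) => z.2.length :=
        Primrec.list_length.comp Primrec.snd
      refine Primrec.ite (Primrec.eq.comp hlen (Primrec.const 0)) (Primrec.const _) ?_
      refine Primrec.option_map (Primrec.list_getElem?.comp Primrec.snd
        (Primrec.nat_div2.comp hlen)) ?_
      exact (Primrec.list_cons.comp (Primrec.nat_bodd.comp (hlen.comp Primrec.fst)) Primrec.snd).to₂
    · intro _ n
      rcases Nat.eq_zero_or_pos n with rfl | hn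
      · simp
      · have h2 : n.div2 < n := by rw [Nat.div2_val]; omega
        have h3 := bits_eq_cons hn
        simp [h2, hn.ne', ← h3]
  exact h.comp (Primrec.const ()) Primrec.id

end Computability

/-! ### Approximations from above by natural numbers -/

/-- `g` is a computable approximation from above of `f` by natural numbers. -/
structure IsNatApprox (g : ℕ → ℕ → ℕ) (f : ℕ → ℕ) : Prop where
  computable : Computable₂ g
  antitone : ∀ n, Antitone (g n)
  le : ∀ n t, f n ≤ g n t
  exists_eq : ∀ n, ∃ t, g n t = f n

theorem IsNatApprox.eq_of_le {g : ℕ → ℕ → ℕ} {f : ℕ → ℕ} (h : IsNatApprox g f) {n s t : ℕ}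
    (hs : g n s = f n) (hst : s ≤ t) : g n t = f n :=
  le_antisymm (hs ▸ h.antitone n hst) (h.le n t)

/-- Rounding down loses nothing: the limit `f n` is an integer, so the floors stay at least `f n`
and equal it once the approximation drops below `f n + 1`. -/
theorem IsRightCE.exists_isNatApprox {f : ℕ → ℕ} (hf : IsRightCE f) :
    ∃ g, IsNatApprox g f := by
  obtain ⟨p, q, hp, hq, h⟩ := hf
  have hfloor : ∀ n t, p n t / 2 ^ q n t = ⌊(p n t : ℝ) / 2 ^ q n t⌋₊ := fun n t => by
    have := Nat.floor_div_eq_div (K := ℝ) (p n t) (2 ^ q n t)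
    push_cast at this
    exact this.symm
  refine ⟨fun n t => p n t / 2 ^ q n t,
    Computable.natDiv hp (Computable.natPow (Computable.const 2) hq), fun n => ?_, fun n t => ?_,
    fun n => ?_⟩
  · intro s t hst
    simp only [hfloor]
    exact Nat.floor_le_floor ((h n).1 hst)
  · simp only [hfloor]
    exact Nat.le_floor ((h n).1.le_of_tendsto (h n).2 t)
  · have hlt : ∀ᶠ t in atTop, (p n t : ℝ) / 2 ^ q n t < f n + 1 :=
      (h n).2.eventually (gt_mem_nhds (lt_add_one _))
    obtain ⟨t, ht⟩ := hlt.exists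
    refine ⟨t, le_antisymm ?_ ?_⟩
    · simp only [hfloor]
      exact Nat.lt_succ_iff.1 ((Nat.floor_lt (by positivity)).2 (by push_cast; exact ht))
    · simp only [hfloor]
      exact Nat.le_floor ((h n).1.le_of_tendsto (h n).2 t)

/-- The contribution of `n` to the stage `t` approximation of `∑ 2 ^ (-f n)`: the numbers `n` and
the values of `g n t` that are not below resp. above `t` are ignored. -/
noncomputable def weight (g : ℕ → ℕ → ℕ) (n t : ℕ) : ℝ :=
  if n < t ∧ g n t ≤ t then (2 : ℝ)⁻¹ ^ g n t else 0

/-- The integer `2 ^ t * weight g n t`. -/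
def scaledWeight (g : ℕ → ℕ → ℕ) (n t : ℕ) : ℕ :=
  if n < t then 2 ^ t / 2 ^ g n t else 0

/-- The cutoff `g n t ≤ t` is built into integer division: the quotient is exact under it and `0`
otherwise. -/
theorem scaledWeight_eq (g : ℕ → ℕ → ℕ) (n t : ℕ) :
    (scaledWeight g n t : ℝ) = 2 ^ t * weight g n t := by
  unfold scaledWeight weight
  by_cases hn : n < t
  · by_cases hg : g n t ≤ t
    · simp only [hn, hg, and_self, if_true]
      rw [Nat.cast_div (pow_dvd_pow 2 hg) (by positivity)]
      push_cast
      rw [inv_pow, div_eq_mul_inv]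
    · simp only [hn, hg, and_false, if_true, if_false, mul_zero]
      rw [Nat.div_eq_of_lt (Nat.pow_lt_pow_right (by norm_num) (not_le.1 hg)), Nat.cast_zero]
  · simp [hn]

theorem weight_nonneg (g : ℕ → ℕ → ℕ) (n t : ℕ) : 0 ≤ weight g n t := by
  unfold weight
  split_ifs <;> positivity

theorem weight_eq_zero {n t : ℕ} (g : ℕ → ℕ → ℕ) (h : t ≤ n) : weight g n t = 0 := by
  simp [weight, h.not_gt]

theorem inv_two_pow_le {a b : ℕ} (h : a ≤ b) : (2 : ℝ)⁻¹ ^ b ≤ 2⁻¹ ^ a :=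
  pow_le_pow_of_le_one (by norm_num) (by norm_num) h

theorem weight_monotone {g : ℕ → ℕ → ℕ} {n : ℕ} (h : Antitone (g n)) :
    Monotone (weight g n) := by
  intro s t hst
  by_cases hs : n < s ∧ g n s ≤ s
  · have ht : n < t ∧ g n t ≤ t := ⟨hs.1.trans_le hst, (h hst).trans (hs.2.trans hst)⟩
    simp only [weight, hs, ht, and_self, if_true]
    exact inv_two_pow_le (h hst)
  · simpa [weight, hs] using weight_nonneg g n t

theorem IsNatApprox.weight_le {g : ℕ → ℕ → ℕ} {f : ℕ → ℕ} (h : IsNatApprox g f) (n t : ℕ) :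
    weight g n t ≤ (2 : ℝ)⁻¹ ^ f n := by
  unfold weight
  split_ifs
  · exact inv_two_pow_le (h.le n t)
  · positivity

theorem IsNatApprox.eventually_weight_eq {g : ℕ → ℕ → ℕ} {f : ℕ → ℕ} (h : IsNatApprox g f)
    (n : ℕ) : ∀ᶠ t in atTop, weight g n t = (2 : ℝ)⁻¹ ^ f n := by
  obtain ⟨s, hs⟩ := h.exists_eq n
  filter_upwards [eventually_ge_atTop s, eventually_gt_atTop n, eventually_ge_atTop (f n)]
    with t h1 h2 h3
  simp [weight, h.eq_of_le hs h1, h2, h3]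

theorem eq_of_weight_eq {g : ℕ → ℕ → ℕ} {f : ℕ → ℕ} {n t : ℕ}
    (h : weight g n t = (2 : ℝ)⁻¹ ^ f n) : g n t = f n := by
  unfold weight at h
  split_ifs at h with hc
  · exact pow_right_injective₀ (by norm_num) (by norm_num) h
  · exact absurd h (by positivity)

/-- The stage `t` approximation of `∑ 2 ^ (-f n)`. -/
noncomputable def approxSum (g : ℕ → ℕ → ℕ) (t : ℕ) : ℝ := ∑ n ∈ Finset.range t, weight g n t

/-- The integer `2 ^ t * approxSum g t`. -/
def scaledSum (g : ℕ → ℕ → ℕ) (t : ℕ) : ℕ := ∑ n ∈ Finset.range t, scaledWeight g n t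

theorem scaledSum_eq (g : ℕ → ℕ → ℕ) (t : ℕ) : (scaledSum g t : ℝ) = 2 ^ t * approxSum g t := by
  simp [scaledSum, approxSum, scaledWeight_eq, Finset.mul_sum]

theorem IsNatApprox.computable_scaledWeight {g : ℕ → ℕ → ℕ} {f : ℕ → ℕ} (h : IsNatApprox g f) :
    Computable₂ (scaledWeight g) :=
  Computable.ifThenElse (ComputablePred.natLT Computable.fst Computable.snd)
    (Computable.natDiv (Computable.natPow (Computable.const 2) Computable.snd)
      (Computable.natPow (Computable.const 2) h.computable)) (Computable.const 0)

theorem IsNatApprox.computable_scaledSum {g : ℕ → ℕ → ℕ} {f : ℕ → ℕ} (h : IsNatApprox g f) :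
    Computable (scaledSum g) :=
  Computable.rangeSum (h := fun t n => scaledWeight g n t)
    (h.computable_scaledWeight.comp Computable.snd Computable.fst) Computable.id

theorem monotone_triangular_sum {u : ℕ → ℕ → ℝ} (hmono : ∀ n, Monotone (u n))
    (hzero : ∀ n t, t ≤ n → u n t = 0) : Monotone fun t => ∑ n ∈ Finset.range t, u n t := by
  intro s t hst
  calc ∑ n ∈ Finset.range s, u n s ≤ ∑ n ∈ Finset.range s, u n t :=
        Finset.sum_le_sum fun n _ => hmono n hst
    _ ≤ ∑ n ∈ Finset.range t, u n t :=
        Finset.sum_le_sum_of_subset_of_nonneg (Finset.range_mono hst) fun n _ _ =>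
          (hzero n 0 n.zero_le).symm.le.trans (hmono n t.zero_le)

theorem triangular_sum_eq_tsum {u : ℕ → ℕ → ℝ} (hzero : ∀ n t, t ≤ n → u n t = 0) (t : ℕ) :
    ∑ n ∈ Finset.range t, u n t = ∑' n, u n t :=
  (tsum_eq_sum fun n hn => hzero n t (by simpa using hn)).symm

theorem tendsto_triangular_sum {u : ℕ → ℕ → ℝ} {v : ℕ → ℝ} (hv : Summable v)
    (hnonneg : ∀ n t, 0 ≤ u n t) (hle : ∀ n t, u n t ≤ v n)
    (hzero : ∀ n t, t ≤ n → u n t = 0) (hlim : ∀ n, ∀ᶠ t in atTop, u n t = v n) :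
    Tendsto (fun t => ∑ n ∈ Finset.range t, u n t) atTop (𝓝 (∑' n, v n)) := by
  simp only [triangular_sum_eq_tsum hzero]
  refine tendsto_tsum_of_dominated_convergence hv
    (fun n => tendsto_const_nhds.congr' ((hlim n).mono fun t ht => ht.symm))
    (Eventually.of_forall fun t n => ?_)
  rw [Real.norm_of_nonneg (hnonneg n t)]
  exact hle n t

theorem IsNatApprox.approxSum_monotone {g : ℕ → ℕ → ℕ} {f : ℕ → ℕ} (h : IsNatApprox g f) :
    Monotone (approxSum g) :=
  monotone_triangular_sum (fun n => weight_monotone (h.antitone n)) fun _ _ => weight_eq_zero g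

theorem IsNatApprox.tendsto_approxSum {g : ℕ → ℕ → ℕ} {f : ℕ → ℕ} (h : IsNatApprox g f)
    (hs : Summable fun n => (2 : ℝ)⁻¹ ^ f n) :
    Tendsto (approxSum g) atTop (𝓝 (∑' n, (2 : ℝ)⁻¹ ^ f n)) :=
  tendsto_triangular_sum hs (weight_nonneg g) h.weight_le (fun _ _ => weight_eq_zero g)
    h.eventually_weight_eq

/-- Between the stages `t` and `t + 1` the contribution of `n` increases. -/
def Changes (g : ℕ → ℕ → ℕ) (n t : ℕ) : Prop := 2 * scaledWeight g n t < scaledWeight g n (t + 1)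

theorem changes_iff {g : ℕ → ℕ → ℕ} {n t : ℕ} :
    Changes g n t ↔ weight g n t < weight g n (t + 1) := by
  unfold Changes
  rw [← Nat.cast_lt (α := ℝ), Nat.cast_mul, scaledWeight_eq, scaledWeight_eq, pow_succ']
  push_cast
  rw [← mul_assoc]
  exact mul_lt_mul_iff_right₀ (by positivity)

theorem IsNatApprox.computablePred_changes {g : ℕ → ℕ → ℕ} {f : ℕ → ℕ} (h : IsNatApprox g f) :
    ComputablePred fun z : ℕ × ℕ => Changes g z.1 z.2 :=
  ComputablePred.natLT (Computable.natMul (Computable.const 2) h.computable_scaledWeight)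
    (h.computable_scaledWeight.comp Computable.fst (Computable.succ.comp Computable.snd))

/-- Weights are `0` or powers of two, so a weight that increases at least doubles, and the increment
is at least half of the new value. -/
theorem Changes.pow_le {g : ℕ → ℕ → ℕ} {n t : ℕ} (h : Changes g n t) :
    (2 : ℝ)⁻¹ ^ g n (t + 1) ≤ 2 * (weight g n (t + 1) - weight g n t) := by
  rw [changes_iff] at h
  have h1 : n < t + 1 ∧ g n (t + 1) ≤ t + 1 := by
    by_contra hc
    rw [weight, weight, if_neg hc] at h
    exact absurd h (not_lt.2 (weight_nonneg g n t))
  have h2 : weight g n (t + 1) = (2 : ℝ)⁻¹ ^ g n (t + 1) := by rw [weight, if_pos h1]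
  rw [h2] at h ⊢
  by_cases hc : n < t ∧ g n t ≤ t
  · rw [weight, if_pos hc] at h ⊢
    have hlt : g n (t + 1) < g n t := (pow_lt_pow_iff_right_of_lt_one₀ (by norm_num)
      (by norm_num)).1 h
    have := inv_two_pow_le (Nat.succ_le_of_lt hlt)
    rw [Nat.succ_eq_add_one, pow_succ] at this
    linarith
  · rw [weight, if_neg hc] at h ⊢
    linarith

/-- The stage is the one just before the weight first reaches its final value. The bound `n ≤ t`,
which holds because `n` is ignored up to stage `n`, places the last change of a large `n` among the
late stages. -/
theorem IsNatApprox.exists_changes {g : ℕ → ℕ → ℕ} {f : ℕ → ℕ} (h : IsNatApprox g f) (n : ℕ) :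
    ∃ t, n ≤ t ∧ Changes g n t ∧ g n (t + 1) = f n := by
  classical
  have hex := (h.eventually_weight_eq n).exists
  have hpos : (0 : ℝ) < 2⁻¹ ^ f n := by positivity
  have hs := Nat.find_spec hex
  have hmin : ∀ m < Nat.find hex, _ := fun m hm => Nat.find_min hex hm
  generalize Nat.find hex = s at hs hmin
  obtain ⟨t, rfl⟩ : ∃ t, s = t + 1 := by
    refine Nat.exists_eq_succ_of_ne_zero ?_
    rintro rfl
    rw [weight_eq_zero g n.zero_le] at hs
    exact hpos.ne hs
  have hnt : n < t + 1 := by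
    by_contra hc
    rw [weight_eq_zero g (not_lt.1 hc)] at hs
    exact hpos.ne hs
  refine ⟨t, by omega, ?_, eq_of_weight_eq hs⟩
  rw [changes_iff, hs]
  exact lt_of_le_of_ne (h.weight_le n t) (hmin t (Nat.lt_succ_self t))

/-! ### The Kraft–Chaitin theorem -/

/-- The number with the big-endian binary expansion `p`. -/
def binVal (p : List Bool) : ℕ := p.foldl (fun a b => 2 * a + b.toNat) 0

theorem foldl_binVal (p : List Bool) (a : ℕ) :
    p.foldl (fun a b => 2 * a + b.toNat) a = a * 2 ^ p.length + binVal p := by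
  induction p generalizing a with
  | nil => simp [binVal]
  | cons b p ih =>
    simp only [binVal, List.foldl_cons, List.length_cons]
    rw [ih, ih (2 * 0 + b.toNat)]
    ring

theorem binVal_append (p r : List Bool) :
    binVal (p ++ r) = binVal p * 2 ^ r.length + binVal r := by
  rw [binVal, List.foldl_append, foldl_binVal]
  rfl

theorem binVal_lt (p : List Bool) : binVal p < 2 ^ p.length := by
  induction p using List.reverseRecOn with
  | nil => simp [binVal]
  | append_singleton p b ih =>
    have hb : binVal [b] ≤ 1 := by cases b <;> simp [binVal]
    rw [binVal_append]
    simp only [List.length_append, List.length_singleton, pow_succ, pow_zero, one_mul]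
    omega

theorem exists_binVal_eq {m k : ℕ} (h : k < 2 ^ m) : ∃ p, p.length = m ∧ binVal p = k := by
  induction m generalizing k with
  | zero => exact ⟨[], rfl, by simp at h; simp [h, binVal]⟩
  | succ m ih =>
    obtain ⟨p, hp, hk⟩ := ih (k := k / 2) (by rw [pow_succ] at h; omega)
    refine ⟨p ++ [decide (k % 2 = 1)], by simp [hp], ?_⟩
    rw [binVal_append, hk]
    have : binVal [decide (k % 2 = 1)] = k % 2 := by
      rcases Nat.mod_two_eq_zero_or_one k with h | h <;> simp [h, binVal]
    rw [this]
    simp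
    omega

theorem computable_binVal : Computable binVal := by
  refine Primrec.to_comp ?_
  refine Primrec.list_foldl (h := fun _ (z : ℕ × Bool) => 2 * z.1 + z.2.toNat) Primrec.id (Primrec.const 0) ?_
  exact (Primrec.nat_add.comp (Primrec.nat_mul.comp (Primrec.const 2)
    (Primrec.fst.comp Primrec.snd)) ((Primrec.dom_bool Bool.toNat).comp
      (Primrec.snd.comp Primrec.snd))).to₂

section KraftChaitin

/-- The partial sums `∑ j < i, 2 ^ (-l j)`, which separate the intervals allotted to the requests. -/
noncomputable def kraftSum (l : ℕ → ℕ) (i : ℕ) : ℝ := ∑ j ∈ Finset.range i, (2 : ℝ)⁻¹ ^ l j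

/-- The number `m` such that `[m, m + 1) / 2 ^ (l i + 1)` is allotted to the request `i`. -/
def kraftCode (l : ℕ → ℕ) (i : ℕ) : ℕ :=
  (∑ j ∈ Finset.range i, 2 ^ (∑ k ∈ Finset.range i, l k - l j)) * 2 ^ (l i + 1) /
    2 ^ (∑ k ∈ Finset.range i, l k) + 1

variable {l : ℕ → ℕ}

theorem kraftSum_monotone : Monotone (kraftSum l) := fun _ _ h =>
  Finset.sum_le_sum_of_subset_of_nonneg (Finset.range_mono h) fun _ _ _ => by positivity

/-- The integer formula uses the common denominator `2 ^ (∑ k < i, l k)` for the partial sum. -/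
theorem kraftCode_eq (i : ℕ) :
    kraftCode l i = ⌊kraftSum l i * 2 ^ (l i + 1)⌋₊ + 1 := by
  have h1 : ((∑ j ∈ Finset.range i, 2 ^ (∑ k ∈ Finset.range i, l k - l j) : ℕ) : ℝ) =
      2 ^ (∑ k ∈ Finset.range i, l k) * kraftSum l i := by
    push_cast
    rw [kraftSum, Finset.mul_sum]
    refine Finset.sum_congr rfl fun j hj => ?_
    rw [pow_sub₀ _ (by norm_num) (Finset.single_le_sum (f := l) (fun _ _ => Nat.zero_le _) hj),
      inv_pow]
  rw [kraftCode, ← Nat.floor_div_eq_div (K := ℝ)]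
  congr 2
  rw [Nat.cast_mul, h1]
  push_cast
  field_simp

theorem lt_kraftCode (i : ℕ) : kraftSum l i * 2 ^ (l i + 1) < kraftCode l i := by
  rw [kraftCode_eq]
  push_cast
  exact Nat.lt_floor_add_one _

/-- Request `i` owns the interval between two consecutive partial sums. Its length is two units of
size `2 ^ (-(l i + 1))`, so the first grid cell starting strictly after its left end still fits.
This is what the extra bit pays for. -/
theorem kraftCode_add_one_le (i : ℕ) :
    (kraftCode l i : ℝ) + 1 ≤ kraftSum l (i + 1) * 2 ^ (l i + 1) := by
  have h0 : 0 ≤ kraftSum l i := Finset.sum_nonneg fun _ _ => by positivity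
  have h1 : kraftSum l (i + 1) * 2 ^ (l i + 1) = kraftSum l i * 2 ^ (l i + 1) + 2 := by
    rw [kraftSum, Finset.sum_range_succ, ← kraftSum, add_mul, inv_pow, pow_succ]
    field_simp
  rw [h1, kraftCode_eq]
  push_cast
  linarith [Nat.floor_le (a := kraftSum l i * 2 ^ (l i + 1)) (by positivity)]

/-- A string codes a dyadic interval, and extending the string shrinks the interval. Intervals of
different requests are separated by the partial sums, so neither can contain the other. -/
theorem kraftCode_prefix {p q : List Bool} {i j : ℕ} (hp : l i + 1 = p.length)
    (hpi : kraftCode l i = binVal p) (hq : l j + 1 = q.length) (hqj : kraftCode l j = binVal q)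
    (hpq : p <+: q) : i = j := by
  obtain ⟨r, rfl⟩ := hpq
  have hlow : (binVal p : ℝ) * 2 ^ r.length ≤ binVal (p ++ r) := by
    rw [binVal_append]; push_cast; linarith [(binVal r).cast_nonneg (α := ℝ)]
  have hhigh : (binVal (p ++ r) : ℝ) + 1 ≤ (binVal p + 1) * 2 ^ r.length := by
    have : (binVal r : ℝ) + 1 ≤ 2 ^ r.length := by exact_mod_cast binVal_lt r
    rw [binVal_append]; push_cast; linarith
  have hpow : (2 : ℝ) ^ (l j + 1) = 2 ^ (l i + 1) * 2 ^ r.length := by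
    rw [hq, hp, List.length_append, pow_add]
  have i1 := lt_kraftCode (l := l) i
  have i2 := kraftCode_add_one_le (l := l) i
  have j1 := lt_kraftCode (l := l) j
  have j2 := kraftCode_add_one_le (l := l) j
  rw [hpi] at i1 i2
  rw [hqj, hpow] at j1 j2
  have hP : (0 : ℝ) < 2 ^ (l i + 1) := by positivity
  have hR : (0 : ℝ) < 2 ^ r.length := by positivity
  have hPR := mul_pos hP hR
  by_contra hne
  rcases Nat.lt_or_gt_of_ne hne with h | h
  · have := mul_le_mul_of_nonneg_right (kraftSum_monotone (l := l) (Nat.succ_le_of_lt h)) hPR.le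
    have := mul_le_mul_of_nonneg_right i2 hR.le
    rw [Nat.succ_eq_add_one] at *
    linarith
  · have := mul_le_mul_of_nonneg_right (kraftSum_monotone (l := l) (Nat.succ_le_of_lt h)) hPR.le
    have := mul_lt_mul_of_pos_right i1 hR
    rw [Nat.succ_eq_add_one] at *
    linarith

theorem computable_kraftCode (hl : Computable l) : Computable (kraftCode l) := by
  have hM : Computable fun i => ∑ k ∈ Finset.range i, l k :=
    Computable.rangeSum (h := fun _ k => l k) (hl.comp Computable.snd) Computable.id
  have hN : Computable fun i =>
      ∑ j ∈ Finset.range i, 2 ^ (∑ k ∈ Finset.range i, l k - l j) :=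
    Computable.rangeSum (h := fun i j => 2 ^ (∑ k ∈ Finset.range i, l k - l j))
      (Computable.natPow (Computable.const 2)
        (Computable.natSub (hM.comp Computable.fst) (hl.comp Computable.snd))) Computable.id
  exact Computable.succ.comp (Computable.natDiv (Computable.natMul hN
    (Computable.natPow (Computable.const 2) (Computable.succ.comp hl)))
    (Computable.natPow (Computable.const 2) hM))

/-- The **Kraft–Chaitin theorem**: a computable sequence of requests for descriptions of `x i` of
length `l i` of finite total weight can be satisfied up to an additive constant. -/
theorem IsUniversalPrefixFree.kraft_chaitin {U : List Bool →. List Bool}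
    (hU : IsUniversalPrefixFree U) {x l : ℕ → ℕ} (hx : Computable x) (hl : Computable l)
    (hs : Summable fun i => (2 : ℝ)⁻¹ ^ l i) :
    ∃ C, ∀ i, ∃ p, Nat.bits (x i) ∈ U p ∧ p.length ≤ l i + C := by
  classical
  -- Lengthening all requests by `C` scales the total weight to at most `1`, so that the codes fit
  -- into the unit interval.
  obtain ⟨C, hC⟩ := pow_unbounded_of_one_lt (∑' i, (2 : ℝ)⁻¹ ^ l i) (one_lt_two (α := ℝ))
  set L : ℕ → ℕ := fun i => l i + C with hL
  have hLc : Computable L := Computable.natAdd hl (Computable.const C)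
  have hsum : ∀ i, kraftSum L i ≤ 1 := fun i => by
    have h1 : kraftSum L i = (∑ j ∈ Finset.range i, (2 : ℝ)⁻¹ ^ l j) * 2⁻¹ ^ C := by
      simp only [kraftSum, hL, pow_add, Finset.sum_mul]
    have h2 : ∑ j ∈ Finset.range i, (2 : ℝ)⁻¹ ^ l j ≤ 2 ^ C :=
      (hs.sum_le_tsum _ fun _ _ => by positivity).trans hC.le
    rw [h1]
    calc _ ≤ (2 : ℝ) ^ C * 2⁻¹ ^ C := by gcongr
      _ = 1 := by rw [← mul_pow]; norm_num
  set P : List Bool → ℕ → Prop := fun p i => L i + 1 = p.length ∧ kraftCode L i = binVal p with hP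
  have hPc : ComputablePred fun z : List Bool × ℕ => P z.1 z.2 :=
    (ComputablePred.equal (Computable.succ.comp (hLc.comp Computable.snd))
      (Computable.list_length.comp Computable.fst)).conj
    (ComputablePred.equal ((computable_kraftCode hLc).comp Computable.snd)
      (computable_binVal.comp Computable.fst))
  set M : List Bool →. List Bool := fun p =>
    (Nat.rfind fun i => Part.some (decide (P p i))).map fun i => Nat.bits (x i) with hM
  have hmem : ∀ p y, y ∈ M p → ∃ i, P p i ∧ Nat.bits (x i) = y := fun p y hy => by
    obtain ⟨i, hi, rfl⟩ := (Part.mem_map_iff _).1 hy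
    have := Nat.rfind_spec hi
    exact ⟨i, by simpa using this, rfl⟩
  have hMp : IsPrefixFreeMachine M := by
    have hr : Partrec fun p => Nat.rfind fun i => Part.some (decide (P p i)) :=
      Partrec.rfind hPc.decide.partrec
    refine ⟨hr.map
      (primrec_bits.to_comp.comp (hx.comp Computable.snd)).to₂, fun p q hp hq hpq => ?_⟩
    obtain ⟨y, hy⟩ := Part.dom_iff_mem.1 hp
    obtain ⟨z, hz⟩ := Part.dom_iff_mem.1 hq
    obtain ⟨i, ⟨h1, h2⟩, -⟩ := hmem p y hy
    obtain ⟨j, ⟨h3, h4⟩, -⟩ := hmem q z hz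
    obtain rfl := kraftCode_prefix h1 h2 h3 h4 hpq
    exact hpq.eq_of_length (h1.symm.trans h3)
  obtain ⟨c, hc⟩ := hU.2 M hMp
  refine ⟨C + 1 + c, fun i => ?_⟩
  obtain ⟨p, hp, hpi⟩ := exists_binVal_eq (m := L i + 1) (k := kraftCode L i) (by
    have h1 := kraftCode_add_one_le (l := L) i
    have h2 : kraftSum L (i + 1) * 2 ^ (L i + 1) ≤ 1 * 2 ^ (L i + 1) := by gcongr; exact hsum _
    have h3 : (kraftCode L i : ℝ) < 2 ^ (L i + 1) := by linarith
    exact_mod_cast h3)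
  have hPp : P p i := ⟨hp.symm, hpi.symm⟩
  -- The search returns the least request served by `p`; it is `i` because `p` serves only one
  -- request.
  obtain ⟨j, hj, -⟩ := Nat.rfind_min' (p := fun i => decide (P p i)) (by simpa using hPp)
  have hPj : P p j := by simpa using Nat.rfind_spec hj
  obtain rfl := kraftCode_prefix hPp.1 hPp.2 hPj.1 hPj.2 List.prefix_rfl
  obtain ⟨q, hq, hlen⟩ := hc p (Nat.bits (x i)) (Part.mem_map _ hj)
  exact ⟨q, hq, by rw [hp] at hlen; simp only [hL] at hlen; omega⟩

end KraftChaitin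

/-! ### Shortest programs and the Kraft inequality. -/

theorem prefixComplexityNat_le {U : List Bool →. List Bool} {n m : ℕ} {p : List Bool}
    (hp : Nat.bits n ∈ U p) (hm : p.length ≤ m) : prefixComplexityNat U n ≤ m :=
  (Nat.sInf_le (s := {l : ℕ | ∃ p : List Bool, Nat.bits n ∈ U p ∧ p.length = l})
    ⟨p, hp, rfl⟩).trans hm

theorem summable_inv_two_pow : Summable fun i : ℕ => (2 : ℝ)⁻¹ ^ i :=
  summable_geometric_of_lt_one (by norm_num) (by norm_num)

/-- An infimum over an empty set of lengths would be the default `0`; this excludes that case, by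
requesting a description of each `n` of length `n`. -/
theorem IsUniversalPrefixFree.exists_program {U : List Bool →. List Bool}
    (hU : IsUniversalPrefixFree U) (n : ℕ) :
    ∃ p, Nat.bits n ∈ U p ∧ p.length = prefixComplexityNat U n := by
  obtain ⟨C, hC⟩ := hU.kraft_chaitin Computable.id Computable.id summable_inv_two_pow
  obtain ⟨p, hp, -⟩ := hC n
  exact Nat.sInf_mem (s := {l : ℕ | ∃ p : List Bool, Nat.bits n ∈ U p ∧ p.length = l}) ⟨_, p, hp, rfl⟩

theorem uniquelyDecodable_of_prefix_free {S : Set (List Bool)}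
    (h : ∀ p ∈ S, ∀ q ∈ S, p <+: q → p = q) (hnil : [] ∉ S) :
    InformationTheory.UniquelyDecodable S := by
  intro L₁
  induction L₁ with
  | nil =>
    intro L₂ _ h₂ heq
    cases L₂ with
    | nil => rfl
    | cons q L₂ =>
      have : q = [] := by simp at heq; exact heq.1
      exact absurd (this ▸ h₂ q (by simp)) hnil
  | cons p L₁ ih =>
    intro L₂ h₁ h₂ heq
    cases L₂ with
    | nil =>
      have : p = [] := by simp at heq; exact heq.1
      exact absurd (this ▸ h₁ p (by simp)) hnil
    | cons q L₂ =>
      simp only [List.flatten_cons] at heq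
      have hpS := h₁ p (by simp)
      have hqS := h₂ q (by simp)
      have hpq : p = q := by
        rcases List.prefix_or_prefix_of_prefix (List.prefix_append p L₁.flatten)
          (heq ▸ List.prefix_append q L₂.flatten) with hp | hp
        · exact h p hpS q hqS hp
        · exact (h q hqS p hpS hp).symm
      subst hpq
      rw [ih L₂ (fun w hw => h₁ w (by simp [hw])) (fun w hw => h₂ w (by simp [hw]))
        (List.append_cancel_left heq)]

theorem kraft_inequality_of_prefix_free {S : Finset (List Bool)}
    (h : ∀ p ∈ S, ∀ q ∈ S, p <+: q → p = q) : ∑ p ∈ S, (2 : ℝ)⁻¹ ^ p.length ≤ 1 := by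
  -- The empty word is a prefix of everything, so it must be the only element; it has to be treated
  -- apart since it spoils unique decodability.
  by_cases hnil : [] ∈ S
  · have : S = {[]} := Finset.eq_singleton_iff_unique_mem.2
      ⟨hnil, fun q hq => (h [] hnil q hq List.nil_prefix).symm⟩
    simp [this]
  · have := InformationTheory.kraft_mcmillan_inequality
      (uniquelyDecodable_of_prefix_free (S := S) (by simpa using h) (by simpa using hnil))
    simpa using this

theorem IsUniversalPrefixFree.sum_inv_two_pow_le {U : List Bool →. List Bool}
    (hU : IsUniversalPrefixFree U) (S : Finset ℕ) :
    ∑ n ∈ S, (2 : ℝ)⁻¹ ^ prefixComplexityNat U n ≤ 1 := by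
  classical
  choose p hp hlen using hU.exists_program
  have hinj : Function.Injective p := fun m n hmn => by
    have h := hp m
    rw [hmn] at h
    exact bits_injective (Part.mem_unique h (hp n))
  have := kraft_inequality_of_prefix_free (S := S.image p) (by
    simp only [Finset.mem_image]
    rintro _ ⟨m, -, rfl⟩ _ ⟨n, -, rfl⟩ hmn
    exact hU.1.2 _ _ (Part.dom_iff_mem.2 ⟨_, hp m⟩) (Part.dom_iff_mem.2 ⟨_, hp n⟩) hmn)
  rw [Finset.sum_image fun _ _ _ _ h => hinj h] at this
  simpa only [hlen] using this

theorem IsUniversalPrefixFree.summable {U : List Bool →. List Bool}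
    (hU : IsUniversalPrefixFree U) :
    Summable fun n => (2 : ℝ)⁻¹ ^ prefixComplexityNat U n :=
  summable_of_sum_le (fun _ => by positivity) hU.sum_inv_two_pow_le

/-! ### Compressing the numbers that contribute to small increments -/

theorem IsNatApprox.tsum_changes_le {g : ℕ → ℕ → ℕ} {f : ℕ → ℕ} (h : IsNatApprox g f) (t : ℕ)
    [∀ n, Decidable (Changes g n t)] :
    ∑' n, (if Changes g n t then (2⁻¹ : ℝ≥0∞) ^ g n (t + 1) else 0) ≤
      2 * ENNReal.ofReal (approxSum g (t + 1) - approxSum g t) := by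
  have hdiff : ∀ n, 0 ≤ weight g n (t + 1) - weight g n t := fun n =>
    sub_nonneg.2 (weight_monotone (h.antitone n) t.le_succ)
  have h1 : approxSum g (t + 1) - approxSum g t =
      ∑ n ∈ Finset.range (t + 1), (weight g n (t + 1) - weight g n t) := by
    rw [Finset.sum_sub_distrib, approxSum, approxSum, Finset.sum_range_succ (fun n => weight g n t),
      weight_eq_zero g le_rfl, add_zero]
  have h2 : ∀ n, (if Changes g n t then (2⁻¹ : ℝ≥0∞) ^ g n (t + 1) else 0) ≤
      2 * ENNReal.ofReal (weight g n (t + 1) - weight g n t) := fun n => by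
    split_ifs with hc
    · have h3 : (2⁻¹ : ℝ≥0∞) ^ g n (t + 1) = ENNReal.ofReal ((2 : ℝ)⁻¹ ^ g n (t + 1)) := by
        rw [ENNReal.ofReal_pow (by norm_num), ENNReal.ofReal_inv_of_pos (by norm_num)]
        simp
      rw [h3]
      refine (ENNReal.ofReal_le_ofReal hc.pow_le).trans ?_
      rw [ENNReal.ofReal_mul (by norm_num)]
      simp
    · exact zero_le
  refine (ENNReal.tsum_le_tsum h2).trans ?_
  rw [ENNReal.tsum_mul_left, h1, ENNReal.ofReal_sum_of_nonneg fun n _ => hdiff n]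
  gcongr
  refine (tsum_eq_sum fun n hn => ?_).le
  have : t + 1 ≤ n := by simpa using hn
  rw [weight_eq_zero g this, weight_eq_zero g (by omega), sub_zero, ENNReal.ofReal_zero]

/-- Truncated subtraction does no harm, since `a ≤ a - c + c` in all cases. -/
theorem ennreal_pow_sub_le (a c : ℕ) : (2⁻¹ : ℝ≥0∞) ^ (a - c) ≤ 2 ^ c * 2⁻¹ ^ a := by
  have h2 : (2 : ℝ≥0∞) ^ c * 2⁻¹ ^ c = 1 := by
    rw [← mul_pow, ENNReal.mul_inv_cancel (by norm_num) (by norm_num), one_pow]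
  calc (2⁻¹ : ℝ≥0∞) ^ (a - c) = 2⁻¹ ^ (a - c) * (2 ^ c * 2⁻¹ ^ c) := by rw [h2, mul_one]
    _ = 2 ^ c * 2⁻¹ ^ (a - c + c) := by rw [pow_add]; ring
    _ ≤ 2 ^ c * 2⁻¹ ^ a := by
      gcongr 2 ^ c * ?_
      exact pow_le_pow_of_le_one zero_le (by simp) (by omega)

/-- Suppose that the increments of the approximations of `∑ 2 ^ (-f n)` at the stages that are
`c`-active have total length `O(4 ^ (-c))`. Then, uniformly in `c`, the numbers that contribute to
these increments have complexity at most `f n - c + O(1)`. -/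
theorem IsNatApprox.exists_program_of_active {U : List Bool →. List Bool}
    (hU : IsUniversalPrefixFree U) {g : ℕ → ℕ → ℕ} {f : ℕ → ℕ} (h : IsNatApprox g f)
    {act : ℕ → ℕ → Prop} [∀ c t, Decidable (act c t)]
    (hact : ComputablePred fun z : ℕ × ℕ => act z.1 z.2) {B : ℝ≥0∞} (hB : B ≠ ∞)
    (hsum : ∀ c, ∑' t, (if act c t then ENNReal.ofReal (approxSum g (t + 1) - approxSum g t)
      else 0) ≤ B * 4⁻¹ ^ c) :
    ∃ C, ∀ c n t, act c t → Changes g n t →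
      prefixComplexityNat U n ≤ g n (t + 1) - c + C := by
  classical
  let z : ℕ → ℕ × ℕ × ℕ := Denumerable.ofNat (ℕ × ℕ × ℕ)
  -- Triples that call for no request still need one, as the sequence is total; length `i` makes the
  -- total weight of these at most `2`.
  let l : ℕ → ℕ := fun i =>
    if act (z i).1 (z i).2.2 ∧ Changes g (z i).2.1 (z i).2.2 then
      g (z i).2.1 ((z i).2.2 + 1) - (z i).1 else i
  have hz : Computable z := (Primrec.ofNat _).to_comp
  have hc : Computable fun i => (z i).1 := Computable.fst.comp hz
  have hn : Computable fun i => (z i).2.1 := Computable.fst.comp (Computable.snd.comp hz)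
  have ht : Computable fun i => (z i).2.2 := Computable.snd.comp (Computable.snd.comp hz)
  have hl : Computable l :=
    Computable.ifThenElse ((hact.comap (Computable.pair hc ht)).conj
      (h.computablePred_changes.comap (Computable.pair hn ht)))
      (Computable.natSub (h.computable.comp hn (Computable.succ.comp ht)) hc) Computable.id
  let F : ℕ × ℕ × ℕ → ℝ≥0∞ := fun y =>
    if act y.1 y.2.2 ∧ Changes g y.2.1 y.2.2 then 2 ^ y.1 * 2⁻¹ ^ g y.2.1 (y.2.2 + 1) else 0
  have hF : ∑' y, F y ≤ 4 * B := by
    -- Shortening by `c` multiplies the weights by at most `2 ^ c`, while active increments sum to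
    -- at most `B * 4 ^ (-c)`; the factor `2` comes from `Changes.pow_le`.
    have hslice : ∀ c, ∑' y : ℕ × ℕ, F (c, y) ≤ 2 * B * 2⁻¹ ^ c := fun c => by
      rw [ENNReal.tsum_prod', ENNReal.tsum_comm]
      calc ∑' t, ∑' n, F (c, n, t)
          ≤ ∑' t, 2 ^ c * 2 * (if act c t then
              ENNReal.ofReal (approxSum g (t + 1) - approxSum g t) else 0) := by
            refine ENNReal.tsum_le_tsum fun t => ?_
            by_cases ha : act c t
            · have : ∀ n, F (c, n, t) =
                  2 ^ c * (if Changes g n t then (2⁻¹ : ℝ≥0∞) ^ g n (t + 1) else 0) := fun n => by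
                simp [F, ha]
              simp only [this, ha, if_true, ENNReal.tsum_mul_left, mul_assoc]
              gcongr
              exact h.tsum_changes_le t
            · simp [F, ha]
        _ ≤ 2 ^ c * 2 * (B * 4⁻¹ ^ c) := by
            rw [ENNReal.tsum_mul_left]
            gcongr
            exact hsum c
        _ = 2 * B * (2 ^ c * 4⁻¹ ^ c) := by ring
        _ = 2 * B * 2⁻¹ ^ c := by
            rw [← mul_pow]
            congr 2
            rw [show (4 : ℝ≥0∞) = 2 * 2 by norm_num, ENNReal.mul_inv (by simp) (by simp),
              ← mul_assoc, ENNReal.mul_inv_cancel (by norm_num) (by norm_num), one_mul]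
    rw [ENNReal.tsum_prod']
    refine (ENNReal.tsum_le_tsum hslice).trans ?_
    rw [ENNReal.tsum_mul_left, ENNReal.tsum_geometric, ENNReal.one_sub_inv_two, inv_inv]
    refine le_of_eq ?_
    ring
  have hfin : ∑' i, (2⁻¹ : ℝ≥0∞) ^ l i ≠ ∞ := by
    have hle : ∀ i, (2⁻¹ : ℝ≥0∞) ^ l i ≤ F (z i) + 2⁻¹ ^ i := fun i => by
      by_cases hi : act (z i).1 (z i).2.2 ∧ Changes g (z i).2.1 (z i).2.2
      · simp only [l, F, if_pos hi]
        exact (ennreal_pow_sub_le _ _).trans le_self_add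
      · simp only [l, if_neg hi]
        exact le_add_self
    have htot : ∑' i, F (z i) = ∑' y, F y := (Denumerable.eqv (ℕ × ℕ × ℕ)).symm.tsum_eq F
    refine ne_top_of_le_ne_top ?_ (ENNReal.tsum_le_tsum hle)
    rw [ENNReal.tsum_add, htot, ENNReal.tsum_geometric, ENNReal.one_sub_inv_two, inv_inv]
    exact ENNReal.add_ne_top.2 ⟨ne_top_of_le_ne_top (ENNReal.mul_ne_top (by simp) hB) hF, by simp⟩
  have hsummable : Summable fun i => (2 : ℝ)⁻¹ ^ l i := by
    simpa using ENNReal.summable_toReal hfin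
  obtain ⟨C, hC⟩ := hU.kraft_chaitin hn hl hsummable
  refine ⟨C, fun c n t ha hch => ?_⟩
  obtain ⟨p, hp, hlen⟩ := hC (Encodable.encode (c, n, t))
  have he : z (Encodable.encode (c, n, t)) = (c, n, t) := Denumerable.ofNat_encode _
  have hle : l (Encodable.encode (c, n, t)) = g n (t + 1) - c := by
    simp only [l, he, if_pos (And.intro ha hch)]
  rw [he] at hp
  rw [hle] at hlen
  exact prefixComplexityNat_le hp hlen

/-! ### Weak Solovay functions have random sums -/

theorem ratOfCode_lt_div_iff (a : ℕ × ℕ × ℕ) (m t : ℕ) :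
    (ratOfCode a : ℝ) < m / 2 ^ t ↔ a.1 * 2 ^ t < m * (a.2.2 + 1) + a.2.1 * 2 ^ t := by
  have h1 : (0 : ℝ) < a.2.2 + 1 := by positivity
  have h2 : (0 : ℝ) < 2 ^ t := by positivity
  rw [← Nat.cast_lt (α := ℝ)]
  simp only [ratOfCode]
  push_cast
  rw [div_lt_div_iff₀ h1 h2, sub_mul, sub_lt_iff_lt_add]

theorem div_lt_ratOfCode_iff (a : ℕ × ℕ × ℕ) (m t : ℕ) :
    m / 2 ^ t < (ratOfCode a : ℝ) ↔ m * (a.2.2 + 1) + a.2.1 * 2 ^ t < a.1 * 2 ^ t := by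
  have h1 : (0 : ℝ) < a.2.2 + 1 := by positivity
  have h2 : (0 : ℝ) < 2 ^ t := by positivity
  rw [← Nat.cast_lt (α := ℝ)]
  simp only [ratOfCode]
  push_cast
  rw [div_lt_div_iff₀ h2 h1, sub_mul, lt_sub_iff_add_lt]

theorem approxSum_eq (g : ℕ → ℕ → ℕ) (t : ℕ) : approxSum g t = scaledSum g t / 2 ^ t := by
  rw [scaledSum_eq]
  field_simp

theorem IsNatApprox.isMartinLofRandom {U : List Bool →. List Bool}
    (hU : IsUniversalPrefixFree U) {g : ℕ → ℕ → ℕ} {f : ℕ → ℕ} (h : IsNatApprox g f)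
    (hs : Summable fun n => (2 : ℝ)⁻¹ ^ f n)
    (hf : ∃ c, ∃ᶠ n in atTop, f n ≤ prefixComplexityNat U n + c) :
    IsMartinLofRandom (∑' n, (2 : ℝ)⁻¹ ^ f n) := by
  classical
  rintro V ⟨⟨W, hW, hV⟩, hvol⟩
  by_contra! hmem
  obtain ⟨P, hPc, hPmono, hP⟩ := hW.exists_stages
  let code : ℕ → (ℕ × ℕ × ℕ) × (ℕ × ℕ × ℕ) := Denumerable.ofNat _
  -- The comparisons of `approxSum g t` and `approxSum g (t + 1)` with the endpoints are cleared of
  -- denominators to make them decidable. The index `2 * c` gives measure `4 ^ (-c)`.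
  let inside : ℕ → ℕ → ℕ → Prop := fun c t j =>
    P (2 * c, code j) t ∧
      (code j).1.1 * 2 ^ t < scaledSum g t * ((code j).1.2.2 + 1) + (code j).1.2.1 * 2 ^ t ∧
      scaledSum g (t + 1) * ((code j).2.2.2 + 1) + (code j).2.2.1 * 2 ^ (t + 1) <
        (code j).2.1 * 2 ^ (t + 1)
  have hinside : ∀ c t j, inside c t j ↔ P (2 * c, code j) t ∧
      (ratOfCode (code j).1 : ℝ) < approxSum g t ∧
      approxSum g (t + 1) < ratOfCode (code j).2 := fun c t j => by
    simp only [inside, approxSum_eq, ratOfCode_lt_div_iff, div_lt_ratOfCode_iff]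
  let act : ℕ → ℕ → Prop := fun c t => ∃ j < t, inside c t j
  have hactc : ComputablePred fun z : ℕ × ℕ => act z.1 z.2 := by
    refine ComputablePred.existsLT (p := fun z j => inside z.1 z.2 j) ?_ Computable.snd
    have hc : Computable fun z : (ℕ × ℕ) × ℕ => z.1.1 := Computable.fst.comp Computable.fst
    have ht : Computable fun z : (ℕ × ℕ) × ℕ => z.1.2 := Computable.snd.comp Computable.fst
    have hj : Computable fun z : (ℕ × ℕ) × ℕ => code z.2 :=
      (Primrec.ofNat _).to_comp.comp Computable.snd
    have hj1 := Computable.fst.comp hj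
    have hj2 := Computable.snd.comp hj
    have hpow : Computable fun z : (ℕ × ℕ) × ℕ => 2 ^ z.1.2 :=
      Computable.natPow (Computable.const 2) ht
    have hpow' : Computable fun z : (ℕ × ℕ) × ℕ => 2 ^ (z.1.2 + 1) :=
      Computable.natPow (Computable.const 2) (Computable.succ.comp ht)
    refine (hPc.comap (Computable.pair (Computable.pair
      (Computable.natMul (Computable.const 2) hc) hj) ht)).conj (ComputablePred.conj ?_ ?_)
    · exact ComputablePred.natLT (Computable.natMul (Computable.fst.comp hj1) hpow)
        (Computable.natAdd (Computable.natMul (h.computable_scaledSum.comp ht)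
          (Computable.succ.comp (Computable.snd.comp (Computable.snd.comp hj1))))
          (Computable.natMul (Computable.fst.comp (Computable.snd.comp hj1)) hpow))
    · exact ComputablePred.natLT
        (Computable.natAdd (Computable.natMul
          (h.computable_scaledSum.comp (Computable.succ.comp ht))
          (Computable.succ.comp (Computable.snd.comp (Computable.snd.comp hj2))))
          (Computable.natMul (Computable.fst.comp (Computable.snd.comp hj2)) hpow'))
        (Computable.natMul (Computable.fst.comp hj2) hpow')
  have hsum : ∀ c, ∑' t, (if act c t then ENNReal.ofReal (approxSum g (t + 1) - approxSum g t)
      else 0) ≤ 1 * 4⁻¹ ^ c := fun c => by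
    let I : ℕ → Set ℝ := fun t =>
      if act c t then Set.Ioo (approxSum g t) (approxSum g (t + 1)) else ∅
    have hI : ∀ t, I t ⊆ Set.Ioo (approxSum g t) (approxSum g (t + 1)) := fun t => by
      by_cases ha : act c t <;> simp [I, ha]
    have hvolI : ∀ t, volume (I t) =
        if act c t then ENNReal.ofReal (approxSum g (t + 1) - approxSum g t) else 0 := fun t => by
      by_cases ha : act c t <;> simp [I, ha]
    have hdisj : Pairwise (Function.onFun Disjoint I) :=
      h.approxSum_monotone.pairwise_disjoint_on_Ioo_succ.mono fun s t hst => hst.mono (hI s) (hI t)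
    have hmeas : ∀ t, MeasurableSet (I t) := fun t => by
      by_cases ha : act c t <;> simp [I, ha]
    have hsub : ⋃ t, I t ⊆ V (2 * c) := by
      refine Set.iUnion_subset fun t x hx => ?_
      have hx' := hI t hx
      have ha : act c t := by
        by_contra ha
        simp [I, ha] at hx
      obtain ⟨j, -, hj⟩ := ha
      obtain ⟨h1, h2, h3⟩ := (hinside c t j).1 hj
      rw [hV]
      exact ⟨_, _, (hP _).2 ⟨t, h1⟩, h2.trans hx'.1, hx'.2.trans h3⟩
    calc _ = ∑' t, volume (I t) := by simp only [hvolI]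
      _ = volume (⋃ t, I t) := (measure_iUnion hdisj hmeas).symm
      _ ≤ volume (V (2 * c)) := measure_mono hsub
      _ ≤ 2⁻¹ ^ (2 * c) := hvol _
      _ = 1 * 4⁻¹ ^ c := by
        rw [pow_mul, one_mul, ← ENNReal.inv_pow]
        norm_num
  obtain ⟨C, hC⟩ := h.exists_program_of_active hU hactc ENNReal.one_ne_top hsum
  obtain ⟨d, hd⟩ := hf
  -- With this `c`, the bounds `K n ≤ f n - c + C` and `f n ≤ K n + d` are incompatible as soon as
  -- `c < f n`.
  set c := C + d + 1 with hcdef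
  have hx := hmem (2 * c)
  rw [hV] at hx
  obtain ⟨a, b, hW', hxa, hxb⟩ := hx
  obtain ⟨k, hk⟩ := (hP _).1 hW'
  have hlim := h.tendsto_approxSum hs
  have hactive : ∀ᶠ t in atTop, act c t := by
    filter_upwards [eventually_gt_atTop (Encodable.encode (a, b)), eventually_ge_atTop k,
      hlim.eventually (lt_mem_nhds hxa)] with t h1 h2 h3
    refine ⟨Encodable.encode (a, b), h1, (hinside _ _ _).2 ?_⟩
    have he : code (Encodable.encode (a, b)) = (a, b) := Denumerable.ofNat_encode _
    rw [he]
    exact ⟨hPmono _ _ _ h2 hk, h3, (h.approxSum_monotone.ge_of_tendsto hlim _).trans_lt hxb⟩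
  obtain ⟨t₀, ht₀⟩ := eventually_atTop.1 hactive
  -- Summability forces `f n > c` eventually, so that `f n - c` is not truncated.
  have hsmall : ∀ᶠ n in atTop, (2 : ℝ)⁻¹ ^ f n < 2⁻¹ ^ c :=
    hs.tendsto_atTop_zero.eventually (gt_mem_nhds (by positivity))
  obtain ⟨n, hfn, hn, hcn⟩ := (hd.and_eventually
    ((eventually_ge_atTop t₀).and hsmall)).exists
  have hcf : c < f n := (pow_lt_pow_iff_right_of_lt_one₀ (by norm_num) (by norm_num)).1 hcn
  obtain ⟨t, hnt, hch, hgt⟩ := h.exists_changes n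
  have := hC c n t (ht₀ t (hn.trans hnt)) hch
  rw [hgt] at this
  omega

/-! ### A Martin-Löf test for reals approximated faster than another left-c.e. real -/

/-- The integer `2 ^ (s + c + 3) * β s`, where `β (s + 1)` is the maximum of `β s` and
`A s / 2 ^ s`, increased by `2 ^ (-c - 3)` times the increment of `G s / 2 ^ s`. -/
def testFrontier (A G : ℕ → ℕ) (c : ℕ) : ℕ → ℕ
  | 0 => 0
  | s + 1 => 2 * max (testFrontier A G c s) (A s * 2 ^ (c + 3)) + (G (s + 1) - 2 * G s)

theorem computable_testFrontier {A G : ℕ → ℕ} (hA : Computable A) (hG : Computable G) :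
    Computable₂ (testFrontier A G) := by
  have hs : Computable fun y : (ℕ × ℕ) × ℕ × ℕ => y.2.1 := Computable.fst.comp Computable.snd
  have hp : Computable fun y : (ℕ × ℕ) × ℕ × ℕ => 2 ^ (y.1.1 + 3) :=
    Computable.natPow (Computable.const 2)
      (Computable.natAdd (Computable.fst.comp Computable.fst) (Computable.const 3))
  have key : Computable fun z : ℕ × ℕ => Nat.rec (motive := fun _ => ℕ) 0
      (fun s b => 2 * max b (A s * 2 ^ (z.1 + 3)) + (G (s + 1) - 2 * G s)) z.2 :=
    Computable.nat_rec (h := fun (z : ℕ × ℕ) (y : ℕ × ℕ) =>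
      2 * max y.2 (A y.1 * 2 ^ (z.1 + 3)) + (G (y.1 + 1) - 2 * G y.1))
      Computable.snd (Computable.const 0)
      (Computable.natAdd (Computable.natMul (Computable.const 2)
        (Computable.natMax (Computable.snd.comp Computable.snd)
          (Computable.natMul (hA.comp hs) hp)))
        (Computable.natSub (hG.comp (Computable.succ.comp hs))
          (Computable.natMul (Computable.const 2) (hG.comp hs)))).to₂
  refine key.of_eq fun z => ?_
  obtain ⟨c, n⟩ := z
  induction n with
  | zero => rfl
  | succ n ih => simp only [testFrontier] at ih ⊢; rw [ih]

/-- A frontier follows the approximations `a` of `x` and is pushed ahead by a small multiple of each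
increment of `γ`. By hypothesis these pushes eventually carry it past `x`; the push that crosses `x`
covers it, and all pushes together are short because `γ` is bounded. -/
theorem not_isMartinLofRandom_of_increments {A G : ℕ → ℕ} (hA : Computable A)
    (hG : Computable G) (hGmono : ∀ s, 2 * G s ≤ G (s + 1)) (hGle : ∀ s, G s ≤ 4 * 2 ^ s) {x : ℝ}
    (hAx : ∀ s, (A s : ℝ) / 2 ^ s ≤ x)
    (hx : ∀ c, ∃ s t, s ≤ t ∧
      x < (A s : ℝ) / 2 ^ s + 2⁻¹ ^ c * ((G t : ℝ) / 2 ^ t - (G s : ℝ) / 2 ^ s)) :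
    ¬ IsMartinLofRandom x := by
  let a : ℕ → ℝ := fun s => (A s : ℝ) / 2 ^ s
  let γ : ℕ → ℝ := fun s => (G s : ℝ) / 2 ^ s
  let β : ℕ → ℕ → ℝ := fun c s => (testFrontier A G c s : ℝ) / 2 ^ (s + c + 3)
  let δ : ℕ → ℕ → ℝ := fun c s => (2 : ℝ)⁻¹ ^ (c + 3) * (γ (s + 1) - γ s)
  have hδ : ∀ c s, δ c s = ((G (s + 1) - 2 * G s : ℕ) : ℝ) / 2 ^ (s + 1 + c + 3) := fun c s => by
    simp only [δ, γ]
    rw [Nat.cast_sub (hGmono s), inv_pow]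
    push_cast
    field_simp
    ring
  have hδ0 : ∀ c s, 0 ≤ δ c s := fun c s => by rw [hδ]; positivity
  have hmax : ∀ c s, max (β c s) (a s) =
      (2 * max (testFrontier A G c s) (A s * 2 ^ (c + 3)) : ℕ) / (2 : ℝ) ^ (s + 1 + c + 3) := by
    intro c s
    have h1 : a s = ((A s * 2 ^ (c + 3) : ℕ) : ℝ) / 2 ^ (s + c + 3) := by
      simp only [a]
      push_cast
      field_simp
      ring
    rw [h1]
    simp only [β]
    rw [max_div_div_right (by positivity), ← Nat.cast_max, Nat.cast_mul]
    push_cast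
    field_simp
    ring
  have hβ : ∀ c s, β c (s + 1) = max (β c s) (a s) + δ c s := fun c s => by
    rw [hmax, hδ, ← add_div, ← Nat.cast_add]
    rfl
  let lo : ℕ → ℕ → ℕ × ℕ × ℕ := fun c s =>
    (2 * max (testFrontier A G c s) (A s * 2 ^ (c + 3)), G (s + 1) - 2 * G s, 2 ^ (s + 1 + c + 3) - 1)
  let hi : ℕ → ℕ → ℕ × ℕ × ℕ := fun c s =>
    (testFrontier A G c (s + 1), 0, 2 ^ (s + 1 + c + 3) - 1)
  have hpow : ∀ k : ℕ, ((2 ^ k - 1 : ℕ) : ℝ) + 1 = 2 ^ k := fun k => by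
    rw [Nat.cast_sub Nat.one_le_two_pow]
    push_cast
    ring
  have hlo : ∀ c s, (ratOfCode (lo c s) : ℝ) = max (β c s) (a s) - δ c s := fun c s => by
    rw [hmax, hδ, ← sub_div]
    simp only [ratOfCode, lo]
    rw [← hpow]
    push_cast
    rfl
  have hhi : ∀ c s, (ratOfCode (hi c s) : ℝ) = max (β c s) (a s) + δ c s := fun c s => by
    rw [← hβ]
    simp only [ratOfCode, hi, β]
    rw [← hpow]
    push_cast
    rw [sub_zero]
  -- The intervals extend to the left as well because they are open and `x` may equal `max (β c s)
  -- (a s)`.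
  let V : ℕ → Set ℝ := fun c =>
    ⋃ s, Set.Ioo (max (β c s) (a s) - δ c s) (max (β c s) (a s) + δ c s)
  have hopen : UniformlyEffectivelyOpen V := by
    refine ⟨fun z => ∃ s, z.2.1 = lo z.1 s ∧ z.2.2 = hi z.1 s, REPred.existsNat ?_, fun c => ?_⟩
    · have hc : Computable fun z : (ℕ × (ℕ × ℕ × ℕ) × (ℕ × ℕ × ℕ)) × ℕ => z.1.1 :=
        Computable.fst.comp Computable.fst
      have hs : Computable fun z : (ℕ × (ℕ × ℕ × ℕ) × (ℕ × ℕ × ℕ)) × ℕ => z.2 := Computable.snd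
      have hs' := Computable.succ.comp hs
      have hF := computable_testFrontier hA hG
      have hden : Computable fun z : (ℕ × (ℕ × ℕ × ℕ) × (ℕ × ℕ × ℕ)) × ℕ =>
          2 ^ (z.2 + 1 + z.1.1 + 3) - 1 :=
        Computable.natSub (Computable.natPow (Computable.const 2) (Computable.natAdd
          (Computable.natAdd hs' hc) (Computable.const 3))) (Computable.const 1)
      have h1 := Computable.fst.comp (Computable.snd.comp
        (Computable.fst (α := ℕ × (ℕ × ℕ × ℕ) × (ℕ × ℕ × ℕ)) (β := ℕ)))
      have h2 := Computable.snd.comp (Computable.snd.comp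
        (Computable.fst (α := ℕ × (ℕ × ℕ × ℕ) × (ℕ × ℕ × ℕ)) (β := ℕ)))
      refine (ComputablePred.equal h1 ?_).conj (ComputablePred.equal h2 ?_)
      · exact Computable.pair (Computable.natMul (Computable.const 2) (Computable.natMax
          (hF.comp hc hs) (Computable.natMul (hA.comp hs) (Computable.natPow (Computable.const 2)
            (Computable.natAdd hc (Computable.const 3))))))
          (Computable.pair (Computable.natSub (hG.comp hs')
            (Computable.natMul (Computable.const 2) (hG.comp hs))) hden)
      · exact Computable.pair (hF.comp hc hs') (Computable.pair (Computable.const 0) hden)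
    · ext y
      simp only [V, Set.mem_iUnion, Set.mem_ofPred_eq]
      constructor
      · rintro ⟨s, hs⟩
        exact ⟨lo c s, hi c s, ⟨s, rfl, rfl⟩, by rwa [hlo, hhi]⟩
      · rintro ⟨_, _, ⟨s, rfl, rfl⟩, hs⟩
        exact ⟨s, by rwa [hlo, hhi] at hs⟩
  -- The lengths telescope to at most `2 * 2 ^ (-c - 3) * 4 = 2 ^ (-c)`, which explains the shift by
  -- `3`.
  have hvol : ∀ c, volume (V c) ≤ (2⁻¹ : ℝ≥0∞) ^ c := fun c => by
    refine (measure_iUnion_le _).trans (ENNReal.tsum_le_of_sum_range_le fun N => ?_)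
    simp only [Real.volume_Ioo]
    rw [← ENNReal.ofReal_sum_of_nonneg fun s _ => by linarith [hδ0 c s]]
    have h1 : ∑ s ∈ Finset.range N,
        (max (β c s) (a s) + δ c s - (max (β c s) (a s) - δ c s)) =
        2 * (2⁻¹ ^ (c + 3) * (γ N - γ 0)) := by
      rw [← Finset.sum_range_sub γ N, Finset.mul_sum, Finset.mul_sum]
      refine Finset.sum_congr rfl fun s _ => ?_
      simp only [δ]
      ring
    have h2 : γ N ≤ 4 := by
      simp only [γ]
      rw [div_le_iff₀ (by positivity)]
      exact_mod_cast hGle N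
    have h3 : 0 ≤ γ 0 := by simp only [γ]; positivity
    have h4 : (2⁻¹ : ℝ≥0∞) ^ c = ENNReal.ofReal (2⁻¹ ^ c) := by
      rw [ENNReal.ofReal_pow (by norm_num), ENNReal.ofReal_inv_of_pos (by norm_num)]
      simp
    rw [h1, h4]
    refine ENNReal.ofReal_le_ofReal ?_
    have h5 : (0 : ℝ) < 2⁻¹ ^ c := by positivity
    rw [pow_add]
    nlinarith
  intro hrand
  obtain ⟨c, hc⟩ := hrand V ⟨hopen, hvol⟩
  refine hc ?_
  obtain ⟨s, t, hst, hlt⟩ := hx (c + 3)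
  have hgrow : ∀ t, s ≤ t → a s + 2⁻¹ ^ (c + 3) * (γ t - γ s) ≤ max (β c t) (a t) := by
    intro t hst
    induction t, hst using Nat.le_induction with
    | base => simp
    | succ t _ ih =>
      refine le_trans ?_ (le_max_left _ _)
      rw [hβ]
      simp only [δ]
      linarith
  have hlt' : x < β c t := by
    rcases lt_max_iff.1 (lt_of_lt_of_le hlt (hgrow t hst)) with h | h
    · exact h
    · exact absurd h (not_lt.2 (hAx t))
  classical
  have hex : ∃ t, x < β c t := ⟨t, hlt'⟩
  have hT := Nat.find_spec hex
  have hmin : ∀ m < Nat.find hex, ¬ x < β c m := fun m hm => Nat.find_min hex hm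
  -- At the first stage `T` with the frontier beyond `x`, the last push started at or below `x`.
  generalize Nat.find hex = T at hT hmin
  obtain ⟨r, rfl⟩ : ∃ r, T = r + 1 := by
    refine Nat.exists_eq_succ_of_ne_zero ?_
    rintro rfl
    have h0 : β c 0 = 0 := by simp [β, testFrontier]
    have h1 : 0 ≤ a 0 := by simp only [a]; positivity
    linarith [show a 0 ≤ x from hAx 0]
  have hle : max (β c r) (a r) ≤ x := max_le (not_lt.1 (hmin r r.lt_succ_self)) (hAx r)
  rw [hβ] at hT
  exact Set.mem_iUnion.2 ⟨r, by linarith, hT⟩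

/-! ### Right-c.e. functions with random sums are weak Solovay functions -/

theorem IsNatApprox.exists_complexity_le {U : List Bool →. List Bool}
    (hU : IsUniversalPrefixFree U) {g : ℕ → ℕ → ℕ} {f : ℕ → ℕ} (h : IsNatApprox g f)
    (hs : Summable fun n => (2 : ℝ)⁻¹ ^ f n) :
    ∃ c, ∀ n, prefixComplexityNat U n ≤ f n + c := by
  classical
  have hsum : ∀ c, ∑' t, (if c = 0 then ENNReal.ofReal (approxSum g (t + 1) - approxSum g t)
      else 0) ≤ ENNReal.ofReal (∑' n, (2 : ℝ)⁻¹ ^ f n) * 4⁻¹ ^ c := fun c => by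
    rcases Nat.eq_zero_or_pos c with rfl | hc
    · simp only [if_true, pow_zero, mul_one]
      refine ENNReal.tsum_le_of_sum_range_le fun N => ?_
      rw [← ENNReal.ofReal_sum_of_nonneg fun t _ => sub_nonneg.2 (h.approxSum_monotone t.le_succ),
        Finset.sum_range_sub]
      refine ENNReal.ofReal_le_ofReal ?_
      have h0 : approxSum g 0 = 0 := by simp [approxSum]
      rw [h0, sub_zero]
      exact h.approxSum_monotone.ge_of_tendsto (h.tendsto_approxSum hs) N
    · simp [hc.ne']
  obtain ⟨C, hC⟩ := h.exists_program_of_active hU (act := fun c _ => c = 0)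
    (ComputablePred.equal Computable.fst (Computable.const 0)) ENNReal.ofReal_ne_top hsum
  refine ⟨C, fun n => ?_⟩
  obtain ⟨t, -, hch, ht⟩ := h.exists_changes n
  have := hC 0 n t rfl hch
  rwa [ht] at this

/-- The bound `g n t + c` supplies a value before any program has been found. The approximation
counts the `m` below this bound for which no program of length at most `m` has appeared; such `m`
form an initial segment, so the count is the smaller of the bound and the least length found. -/
theorem IsNatApprox.exists_complexity_approx {U : List Bool →. List Bool}
    (hU : IsUniversalPrefixFree U) {g : ℕ → ℕ → ℕ} {f : ℕ → ℕ} (h : IsNatApprox g f) {c : ℕ}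
    (hc : ∀ n, prefixComplexityNat U n ≤ f n + c) :
    ∃ k, IsNatApprox k (prefixComplexityNat U) := by
  classical
  obtain ⟨F, hF, hmono, hlim⟩ := Partrec.exists_stages hU.1.1
  let p : ℕ → List Bool := fun j => (Encodable.decode (α := List Bool) j).getD []
  have hpc : Computable p := (Primrec.option_getD.comp Primrec.decode (Primrec.const _)).to_comp
  let found : ℕ → ℕ → ℕ → Prop := fun n t m =>
    ∃ j < t, (p j).length ≤ m ∧ F (p j) t = some (Nat.bits n)
  have hfmono : ∀ n s t m, s ≤ t → found n s m → found n t m := by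
    rintro n s t m hst ⟨j, hj, hl, hx⟩
    exact ⟨j, hj.trans_le hst, hl, hmono _ _ _ _ hst hx⟩
  have hfound : ∀ n t m, found n t m → prefixComplexityNat U n ≤ m := by
    rintro n t m ⟨j, -, hl, hx⟩
    exact prefixComplexityNat_le ((hlim _ _).2 ⟨t, hx⟩) hl
  have hfc : ComputablePred fun z : (ℕ × ℕ) × ℕ => found z.1.1 z.1.2 z.2 := by
    have hj : Computable fun y : ((ℕ × ℕ) × ℕ) × ℕ => p y.2 := hpc.comp Computable.snd
    have ht : Computable fun y : ((ℕ × ℕ) × ℕ) × ℕ => y.1.1.2 :=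
      Computable.snd.comp (Computable.fst.comp Computable.fst)
    refine ComputablePred.existsLT
      (p := fun z j => (p j).length ≤ z.2 ∧ F (p j) z.1.2 = some (Nat.bits z.1.1)) ?_
      (Computable.snd.comp Computable.fst)
    exact (ComputablePred.natLE (Computable.list_length.comp hj)
      (Computable.snd.comp Computable.fst)).conj
      (ComputablePred.equal (hF.comp hj ht) (Computable.option_some.comp
        (primrec_bits.to_comp.comp (Computable.fst.comp (Computable.fst.comp Computable.fst)))))
  refine ⟨fun n t => ∑ m ∈ Finset.range (g n t + c), if found n t m then 0 else 1,
    ?_, fun n s t hst => ?_, fun n t => ?_, fun n => ?_⟩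
  · exact Computable.rangeSum (h := fun (z : ℕ × ℕ) m => if found z.1 z.2 m then 0 else 1)
      (Computable.ifThenElse hfc (Computable.const 0) (Computable.const 1))
      (Computable.natAdd h.computable (Computable.const c))
  · calc (∑ m ∈ Finset.range (g n t + c), if found n t m then 0 else 1)
        ≤ ∑ m ∈ Finset.range (g n s + c), if found n t m then 0 else 1 :=
          Finset.sum_le_sum_of_subset (Finset.range_mono (by have := h.antitone n hst; omega))
      _ ≤ ∑ m ∈ Finset.range (g n s + c), if found n s m then 0 else 1 := by
          refine Finset.sum_le_sum fun m _ => ?_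
          by_cases hm : found n s m
          · simp [hm, hfmono n s t m hst hm]
          · simp only [hm, if_false]; split_ifs <;> simp
  · calc prefixComplexityNat U n
        = ∑ m ∈ Finset.range (prefixComplexityNat U n), 1 := by simp
      _ = ∑ m ∈ Finset.range (prefixComplexityNat U n), if found n t m then 0 else 1 := by
          refine Finset.sum_congr rfl fun m hm => ?_
          rw [if_neg fun hm' => (Finset.mem_range.1 hm).not_ge (hfound n t m hm')]
      _ ≤ _ := Finset.sum_le_sum_of_subset (Finset.range_mono
          ((hc n).trans (by have := h.le n t; omega)))
  · obtain ⟨q, hq, hlen⟩ := hU.exists_program n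
    obtain ⟨s, hs⟩ := (hlim _ _).1 hq
    set t := max s (Encodable.encode q + 1)
    have hpq : p (Encodable.encode q) = q := by simp [p]
    have hm : ∀ m, prefixComplexityNat U n ≤ m → found n t m := fun m hm =>
      ⟨Encodable.encode q, (Nat.lt_succ_self _).trans_le (le_max_right _ _),
        by rw [hpq, hlen]; exact hm, by rw [hpq]; exact hmono _ _ _ _ (le_max_left _ _) hs⟩
    have hiff : ∀ m, found n t m ↔ prefixComplexityNat U n ≤ m :=
      fun m => ⟨hfound n t m, hm m⟩
    refine ⟨t, ?_⟩
    have hle : prefixComplexityNat U n ≤ g n t + c := (hc n).trans (by have := h.le n t; omega)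
    simp only [hiff]
    rw [← Finset.sum_subset (Finset.range_mono hle) fun m _ hm => if_pos (by simpa using hm)]
    rw [Finset.sum_congr rfl fun m hm => if_neg (by simpa using hm)]
    simp

/-- A quantity that is comparable with `2 ^ (-k)` while `a ≤ k`, and that increases, as `a`
decreases towards `k`, much faster than `2 ^ (-a)` while `a - k` is large. -/
noncomputable def potential (a k : ℕ) : ℝ := ((max a k - k : ℕ) + 2) * 2⁻¹ ^ max a k

theorem potential_nonneg (a k : ℕ) : 0 ≤ potential a k := by unfold potential; positivity

theorem potential_add (k d : ℕ) : potential (k + d) k = (d + 2) * 2⁻¹ ^ (k + d) := by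
  simp [potential]

theorem potential_of_le {a k : ℕ} (h : a ≤ k) : potential a k = 2 * 2⁻¹ ^ k := by
  simp [potential, h]

theorem potential_antitone_left (k : ℕ) : Antitone fun a => potential a k := by
  refine antitone_nat_of_succ_le fun a => ?_
  rcases Nat.lt_or_ge a k with h | h
  · rw [potential_of_le h, potential_of_le h.le]
  · obtain ⟨d, rfl⟩ := Nat.exists_eq_add_of_le h
    rw [add_assoc, potential_add, potential_add, ← add_assoc, pow_succ]
    push_cast
    have : (0 : ℝ) < 2⁻¹ ^ (k + d) := by positivity
    nlinarith [d.cast_nonneg (α := ℝ)]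

theorem potential_antitone_right (a : ℕ) : Antitone (potential a) := by
  refine antitone_nat_of_succ_le fun k => ?_
  rcases Nat.lt_or_ge k a with h | h
  · unfold potential
    rw [max_eq_left h, max_eq_left h.le]
    gcongr
    omega
  · rw [potential_of_le h, potential_of_le (h.trans k.le_succ)]
    linarith [inv_two_pow_le k.le_succ]

theorem potential_le (a k : ℕ) : potential a k ≤ 2 * 2⁻¹ ^ k := by
  rcases le_total a k with h | h
  · rw [potential_of_le h]
  · rw [← potential_of_le le_rfl]
    exact potential_antitone_left k h

/-- Lowering the first argument from `k + d + 1` to `k + d` raises `potential` by exactly `d + 1`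
times the increase of `2 ^ (-a)`, and `d ≥ m` throughout. -/
theorem mul_sub_le_potential_sub {k m a b : ℕ} (hka : k + m ≤ a) (hab : a ≤ b) :
    m * ((2 : ℝ)⁻¹ ^ a - 2⁻¹ ^ b) ≤ potential a k - potential b k := by
  induction b, hab using Nat.le_induction with
  | base => simp
  | succ b hab ih =>
    obtain ⟨d, rfl⟩ := Nat.exists_eq_add_of_le (show k ≤ b by omega)
    have hd : (m : ℝ) ≤ d := by
      have : m ≤ d := by omega
      exact_mod_cast this
    have hp : (0 : ℝ) < 2⁻¹ ^ (k + d) := by positivity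
    rw [add_assoc, potential_add, ← add_assoc, pow_succ]
    rw [potential_add] at ih
    push_cast
    nlinarith

theorem mul_le_potential {k m a : ℕ} (hka : k + m ≤ a) :
    m * (2 : ℝ)⁻¹ ^ a ≤ potential a k := by
  obtain ⟨d, rfl⟩ := Nat.exists_eq_add_of_le (show k ≤ a by omega)
  rw [potential_add]
  have hd : (m : ℝ) ≤ d := by
    have : m ≤ d := by omega
    exact_mod_cast this
  gcongr
  linarith

theorem IsNatApprox.max {g k : ℕ → ℕ → ℕ} {f K : ℕ → ℕ} (hg : IsNatApprox g f)
    (hk : IsNatApprox k K) :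
    IsNatApprox (fun n t => max (g n t) (k n t)) fun n => max (f n) (K n) where
  computable := Computable.natMax hg.computable hk.computable
  antitone n _ _ hst := max_le_max (hg.antitone n hst) (hk.antitone n hst)
  le n t := max_le_max (hg.le n t) (hk.le n t)
  exists_eq n := by
    obtain ⟨s, hs⟩ := hg.exists_eq n
    obtain ⟨t, ht⟩ := hk.exists_eq n
    exact ⟨Max.max s t, by
      rw [hg.eq_of_le hs (le_max_left _ _), hk.eq_of_le ht (le_max_right _ _)]⟩

/-- The contribution of `n` to the stage `t` approximation of `∑ n, potential (f n) (K n)`. -/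
noncomputable def potentialWeight (g k : ℕ → ℕ → ℕ) (n t : ℕ) : ℝ :=
  ((max (g n t) (k n t) - k n t : ℕ) + 2) * weight (fun n t => max (g n t) (k n t)) n t

theorem potentialWeight_eq (g k : ℕ → ℕ → ℕ) (n t : ℕ) : potentialWeight g k n t =
    if n < t ∧ max (g n t) (k n t) ≤ t then potential (g n t) (k n t) else 0 := by
  unfold potentialWeight weight potential
  split_ifs <;> simp

theorem potentialWeight_nonneg (g k : ℕ → ℕ → ℕ) (n t : ℕ) : 0 ≤ potentialWeight g k n t := by
  rw [potentialWeight_eq]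
  split_ifs
  · exact potential_nonneg _ _
  · exact le_rfl

theorem potentialWeight_eq_zero (g k : ℕ → ℕ → ℕ) {n t : ℕ} (h : t ≤ n) :
    potentialWeight g k n t = 0 := by
  simp [potentialWeight_eq, h.not_gt]

section Potential

variable {g k : ℕ → ℕ → ℕ} {f K : ℕ → ℕ}

theorem potentialWeight_le (hg : IsNatApprox g f) (hk : IsNatApprox k K) (n t : ℕ) :
    potentialWeight g k n t ≤ potential (f n) (K n) := by
  rw [potentialWeight_eq]
  split_ifs
  · exact (potential_antitone_left _ (hg.le n t)).trans (potential_antitone_right _ (hk.le n t))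
  · exact potential_nonneg _ _

theorem potentialWeight_monotone (hg : IsNatApprox g f) (hk : IsNatApprox k K) (n : ℕ) :
    Monotone (potentialWeight g k n) := by
  intro s t hst
  have hmax := (hg.max hk).antitone n hst
  by_cases hs : n < s ∧ max (g n s) (k n s) ≤ s
  · have ht : n < t ∧ max (g n t) (k n t) ≤ t := ⟨hs.1.trans_le hst, hmax.trans (hs.2.trans hst)⟩
    rw [potentialWeight_eq, potentialWeight_eq, if_pos hs, if_pos ht]
    exact (potential_antitone_left _ (hg.antitone n hst)).trans
      (potential_antitone_right _ (hk.antitone n hst))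
  · rw [potentialWeight_eq, if_neg hs]
    exact potentialWeight_nonneg g k n t

theorem eventually_potentialWeight_eq (hg : IsNatApprox g f) (hk : IsNatApprox k K) (n : ℕ) :
    ∀ᶠ t in atTop, potentialWeight g k n t = potential (f n) (K n) := by
  obtain ⟨s, hs⟩ := hg.exists_eq n
  obtain ⟨r, hr⟩ := hk.exists_eq n
  filter_upwards [eventually_ge_atTop s, eventually_ge_atTop r, eventually_gt_atTop n,
    eventually_ge_atTop (max (f n) (K n))] with t h1 h2 h3 h4
  rw [potentialWeight_eq, hg.eq_of_le hs h1, hk.eq_of_le hr h2, if_pos ⟨h3, h4⟩]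

/-- Replacing the current `k n t` by its limit `K n` only increases the potential, so it suffices to
compare the values of `g`. If `n` is not yet counted, the whole final potential is still missing. -/
theorem mul_sub_weight_le (hg : IsNatApprox g f) (hk : IsNatApprox k K) {m n : ℕ}
    (hm : K n + m ≤ f n) (t : ℕ) :
    m * ((2 : ℝ)⁻¹ ^ f n - weight g n t) ≤ potential (f n) (K n) - potentialWeight g k n t := by
  by_cases hc : n < t ∧ max (g n t) (k n t) ≤ t
  · have hw : weight g n t = 2⁻¹ ^ g n t := by
      rw [weight, if_pos ⟨hc.1, (le_max_left _ _).trans hc.2⟩]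
    rw [potentialWeight_eq, if_pos hc, hw]
    linarith [mul_sub_le_potential_sub hm (hg.le n t), potential_antitone_right (g n t) (hk.le n t)]
  · rw [potentialWeight_eq, if_neg hc, sub_zero]
    refine le_trans ?_ (mul_le_potential hm)
    gcongr
    linarith [weight_nonneg g n t]

/-- The integer `2 ^ t * ∑ n < t, potentialWeight g k n t`. -/
def scaledPotentialSum (g k : ℕ → ℕ → ℕ) (t : ℕ) : ℕ :=
  ∑ n ∈ Finset.range t, (max (g n t) (k n t) - k n t + 2) *
    scaledWeight (fun n t => max (g n t) (k n t)) n t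

theorem scaledPotentialSum_eq (g k : ℕ → ℕ → ℕ) (t : ℕ) :
    (scaledPotentialSum g k t : ℝ) = 2 ^ t * ∑ n ∈ Finset.range t, potentialWeight g k n t := by
  rw [scaledPotentialSum, Finset.mul_sum, Nat.cast_sum]
  refine Finset.sum_congr rfl fun n _ => ?_
  rw [Nat.cast_mul, scaledWeight_eq, potentialWeight]
  push_cast
  ring

theorem computable_scaledPotentialSum (hg : IsNatApprox g f) (hk : IsNatApprox k K) :
    Computable (scaledPotentialSum g k) := by
  refine Computable.rangeSum (h := fun t n => (Max.max (g n t) (k n t) - k n t + 2) *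
    scaledWeight (fun n t => Max.max (g n t) (k n t)) n t) ?_ Computable.id
  have hn : Computable fun z : ℕ × ℕ => z.2 := Computable.snd
  have ht : Computable fun z : ℕ × ℕ => z.1 := Computable.fst
  exact Computable.natMul (Computable.natAdd (Computable.natSub
    ((hg.max hk).computable.comp hn ht) (hk.computable.comp hn ht)) (Computable.const 2))
    ((hg.max hk).computable_scaledWeight.comp hn ht)

theorem not_isMartinLofRandom_of_gap (hg : IsNatApprox g f) (hk : IsNatApprox k K)
    (hf : Summable fun n => (2 : ℝ)⁻¹ ^ f n) (hK : Summable fun n => (2 : ℝ)⁻¹ ^ K n)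
    (hK1 : ∑' n, (2 : ℝ)⁻¹ ^ K n ≤ 1) (hgap : ∀ m, ∀ᶠ n in atTop, K n + m ≤ f n) :
    ¬ IsMartinLofRandom (∑' n, (2 : ℝ)⁻¹ ^ f n) := by
  let v : ℕ → ℝ := fun n => potential (f n) (K n)
  let u : ℕ → ℕ → ℝ := potentialWeight g k
  let γ : ℕ → ℝ := fun t => ∑ n ∈ Finset.range t, u n t
  have hv : Summable v := Summable.of_nonneg_of_le (fun n => potential_nonneg _ _)
    (fun n => potential_le _ _) (hK.mul_left 2)
  have hv2 : ∑' n, v n ≤ 2 := by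
    calc ∑' n, v n ≤ ∑' n, 2 * (2 : ℝ)⁻¹ ^ K n :=
          hv.tsum_le_tsum (fun n => potential_le _ _) (hK.mul_left 2)
      _ ≤ 2 := by rw [tsum_mul_left]; linarith
  have hzero : ∀ n t, t ≤ n → u n t = 0 := fun n t h => potentialWeight_eq_zero g k h
  have hγmono : Monotone γ :=
    monotone_triangular_sum (potentialWeight_monotone hg hk) hzero
  have hγlim : Tendsto γ atTop (𝓝 (∑' n, v n)) :=
    tendsto_triangular_sum hv (potentialWeight_nonneg g k) (potentialWeight_le hg hk) hzero
      (eventually_potentialWeight_eq hg hk)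
  have hγle : ∀ t, γ t ≤ 2 := fun t => (hγmono.ge_of_tendsto hγlim t).trans hv2
  -- The summand `1 - 2 ^ (-t)` makes the quantity strictly increasing, which yields the strict
  -- inequality required by the test; the bound becomes `2 + 1 ≤ 4`.
  let G : ℕ → ℕ := fun t => scaledPotentialSum g k t + (2 ^ t - 1)
  have hpow : ∀ t : ℕ, ((2 ^ t - 1 : ℕ) : ℝ) = 2 ^ t - 1 := fun t => by
    rw [Nat.cast_sub Nat.one_le_two_pow]
    push_cast
    ring
  have hGeq : ∀ t, (G t : ℝ) = 2 ^ t * γ t + (2 ^ t - 1) := fun t => by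
    simp only [G, Nat.cast_add, scaledPotentialSum_eq, hpow]
    rfl
  have hGdiv : ∀ t, (G t : ℝ) / 2 ^ t = γ t + 1 - 2⁻¹ ^ t := fun t => by
    rw [hGeq, inv_pow]
    field_simp
    ring
  refine not_isMartinLofRandom_of_increments (A := scaledSum g) (G := G) hg.computable_scaledSum
    (Computable.natAdd (computable_scaledPotentialSum hg hk) (Computable.natSub
      (Computable.natPow (Computable.const 2) Computable.id) (Computable.const 1)))
    (fun t => ?_) (fun t => ?_) (fun t => ?_) fun c => ?_
  · have h1 : (2 : ℝ) ^ (t + 1) * γ t ≤ 2 ^ (t + 1) * γ (t + 1) := by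
      gcongr
      exact hγmono t.le_succ
    have h2 : (2 : ℝ) * G t ≤ G (t + 1) := by
      rw [hGeq, hGeq]
      rw [pow_succ] at h1 ⊢
      linarith
    exact_mod_cast h2
  · have h1 : (2 : ℝ) ^ t * γ t ≤ 2 ^ t * 2 := by gcongr; exact hγle t
    have h2 : (G t : ℝ) ≤ 4 * 2 ^ t := by
      rw [hGeq]
      linarith [show (0 : ℝ) < 2 ^ t by positivity]
    exact_mod_cast h2
  · rw [← approxSum_eq]
    exact hg.approxSum_monotone.ge_of_tendsto (hg.tendsto_approxSum hf) t
  -- From `n₀` on the gap exceeds the required factor `2 ^ c`; the finitely many smaller numbers are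
  -- disposed of by a stage `s` at which their weights are final.
  · obtain ⟨n₀, hn₀⟩ := eventually_atTop.1 (hgap (2 ^ c))
    have hinit : ∀ᶠ t in atTop, ∀ n ∈ Finset.range n₀, weight g n t = 2⁻¹ ^ f n :=
      (Filter.eventually_all_finset _).2 fun n _ => hg.eventually_weight_eq n
    obtain ⟨s, hs⟩ := hinit.exists
    have hterm : ∀ n, (2 : ℝ) ^ c * (2⁻¹ ^ f n - weight g n s) ≤ v n - u n s := fun n => by
      rcases Nat.lt_or_ge n n₀ with h | h
      · rw [hs n (Finset.mem_range.2 h), sub_self, mul_zero]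
        exact sub_nonneg.2 (potentialWeight_le hg hk n s)
      · have := mul_sub_weight_le hg hk (hn₀ n h) s
        push_cast at this
        exact this
    have hw : Summable fun n => weight g n s :=
      Summable.of_nonneg_of_le (fun n => weight_nonneg g n s) (fun n => hg.weight_le n s) hf
    have hu : Summable fun n => u n s :=
      Summable.of_nonneg_of_le (fun n => potentialWeight_nonneg g k n s)
        (fun n => potentialWeight_le hg hk n s) hv
    have hsum : (2 : ℝ) ^ c * (∑' n, (2 : ℝ)⁻¹ ^ f n - approxSum g s) ≤ ∑' n, v n - γ s := by
      have h1 : approxSum g s = ∑' n, weight g n s :=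
        triangular_sum_eq_tsum (fun _ _ => weight_eq_zero g) s
      have h2 : γ s = ∑' n, u n s := triangular_sum_eq_tsum hzero s
      rw [h1, h2, ← hf.tsum_sub hw, ← hv.tsum_sub hu, ← tsum_mul_left]
      exact ((hf.sub hw).mul_left _).tsum_le_tsum hterm (hv.sub hu)
    have hlim : Tendsto (fun t => γ t + 1 - 2⁻¹ ^ t) atTop (𝓝 (∑' n, v n + 1 - 0)) :=
      (hγlim.add_const 1).sub
        (tendsto_pow_atTop_nhds_zero_of_lt_one (by norm_num) (by norm_num))
    have hlt : ∑' n, v n + 1 - 2⁻¹ ^ s < ∑' n, v n + 1 - 0 := by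
      have : (0 : ℝ) < 2⁻¹ ^ s := by positivity
      linarith
    obtain ⟨t, hst, ht⟩ := ((eventually_ge_atTop s).and
      (hlim.eventually (lt_mem_nhds hlt))).exists
    refine ⟨s, t, hst, ?_⟩
    rw [hGdiv, hGdiv, ← approxSum_eq]
    have hc : (0 : ℝ) < 2 ^ c := by positivity
    rw [inv_pow, ← sub_lt_iff_lt_add', ← div_eq_inv_mul, lt_div_iff₀ hc]
    linarith

end Potential

theorem theorem2p2 (U : List Bool →. List Bool) (hU : IsUniversalPrefixFree U)
    (f : ℕ → ℕ) (hf : IsRightCE f) :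
    IsWeakSolovay U f ↔
      Summable (fun n : ℕ => (2 : ℝ)⁻¹ ^ f n) ∧
        IsMartinLofRandom (∑' n : ℕ, (2 : ℝ)⁻¹ ^ f n) := by
  obtain ⟨g, hg⟩ := hf.exists_isNatApprox
  constructor
  · rintro ⟨-, ⟨c, hc⟩, hfreq⟩
    have hs : Summable fun n : ℕ => (2 : ℝ)⁻¹ ^ f n := by
      refine Summable.of_nonneg_of_le (fun n => by positivity) (fun n => ?_)
        (hU.summable.mul_left (2 ^ c))
      calc (2 : ℝ)⁻¹ ^ f n = 2 ^ c * 2⁻¹ ^ (f n + c) := by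
            rw [pow_add, mul_left_comm, ← mul_pow]
            norm_num
        _ ≤ 2 ^ c * 2⁻¹ ^ prefixComplexityNat U n := by
            gcongr 2 ^ c * ?_
            exact inv_two_pow_le (hc n)
    exact ⟨hs, hg.isMartinLofRandom hU hs hfreq⟩
  · rintro ⟨hs, hrand⟩
    obtain ⟨c, hc⟩ := hg.exists_complexity_le hU hs
    refine ⟨hf, ⟨c, hc⟩, ?_⟩
    -- The negation says that `f - K` exceeds each constant for almost all `n`.
    by_contra! hcon
    obtain ⟨k, hk⟩ := hg.exists_complexity_approx hU hc
    refine not_isMartinLofRandom_of_gap hg hk hs hU.summable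
      (hU.summable.tsum_le_of_sum_le hU.sum_inv_two_pow_le) (fun m => ?_) hrand
    filter_upwards [hcon m] with n hn
    exact hn.le
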